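/- Let $\Theta\subset\mathbb R$ be a measurable set, let $f(x\mid\theta)\ge 0$ be measurable in $\theta$ (for instance a family of probability densities in $x$), let $\pi\ge 0$ be a measurable prior density on $\Theta$ (not necessarily normalized), and fix a sequence of observations $x_1,x_2,\dots$. Put $L_n(\theta)=\prod_{i=1}^n f(x_i\mid\theta)$ and $\bar\ell_n(\theta)=\frac1n\log L_n(\theta)$ (with $\log 0=-\infty$). Suppose there are constants $\varepsilon,\delta,c>0$, $m\ge 0$, $M,C$ and $n_0$, all independent of $n$, such that for every $n\ge n_0$: (i) $L_n$ has a single global maximizer $\hat\theta_n$ over $\Theta$; the interval $N_n=(\hat\theta_n-\varepsilon,\hat\theta_n+\varepsilon)$ is contained in $\Theta$, and $L_n>0$ and $\pi>0$ on $N_n$; (ii) $\bar\ell_n$ and $\log\pi$ have six continuous derivatives on $N_n$, with $|\bar\ell_n^{(j)}|\le M$ for $2\le j\le 6$ and $|(\log\pi)^{(j)}|\le M$ for $0\le j\le 6$ on $N_n$; (iii) $\bar\ell_n(\theta)<\bar\ell_n(\hat\theta_n)-\delta$ for all $\theta\in\Theta\setminus N_n$; (iv) $|\bar\ell_n''|\ge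 c$ on $N_n$; (v) $\int_\Theta|\theta-\hat\theta_n|^5\,\pi(\theta)\,\bigl(L_n(\theta)/L_n(\hat\theta_n)\bigr)^{m/n}\,d\theta\le C$ (the weight equals $\exp\{m(\bar\ell_n(\theta)-\bar\ell_n(\hat\theta_n))\}$; for $m=0$ this is a condition on the fifth absolute moment of the prior about $\hat\theta_n$). Then, for all sufficiently large $n$, the posterior density $\pi(\theta)L_n(\theta)/\int_\Theta\pi(t) L_n(t)\,dt$ defines a probability distribution on $\Theta$ with finite fifth absolute moment and positive standard deviation. Let $\theta_0$ and $\sigma$ (both depending on $n$) be its expectation and standard deviation, and let $\kappa_j$, the invariant cumulant of order $j$, be the cumulant of order $j$ of $(\theta-\theta_0)/\sigma$ under the posterior. Then, as $n\to\infty$, $\kappa_j=O(n^{(2-j)/2})$ for $j\in\{3,4,5\}$. -/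

import Mathlib

open MeasureTheory ProbabilityTheory Filter Asymptotics

noncomputable section

/-- The likelihood `L_n(θ) = ∏_{i ≤ n} f(x_i | θ)` of the first `n` observations. -/
def likelihood {𝓧 : Type*} (f : 𝓧 → ℝ → ℝ) (x : ℕ → 𝓧) (n : ℕ) (θ : ℝ) : ℝ :=
  ∏ i ∈ Finset.range n, f (x i) θ

/-- The average loglikelihood `log L_n(θ) / n`. It is only meaningful where `L_n(θ) > 0`. -/
def avgLogLik {𝓧 : Type*} (f : 𝓧 → ℝ → ℝ) (x : ℕ → 𝓧) (n : ℕ) (θ : ℝ) : ℝ :=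
  Real.log (likelihood f x n θ) / n

/-- The posterior density of `θ ∈ Θ` with respect to Lebesgue measure,
`π(θ) L_n(θ) / ∫_Θ π(t) L_n(t) dt`. -/
def posteriorDensity {𝓧 : Type*} (Θ : Set ℝ) (f : 𝓧 → ℝ → ℝ) (prior : ℝ → ℝ) (x : ℕ → 𝓧)
    (n : ℕ) (θ : ℝ) : ℝ :=
  prior θ * likelihood f x n θ / ∫ t in Θ, prior t * likelihood f x n t

/-- The posterior distribution of the parameter, as a measure on `ℝ` carried by `Θ`. -/
def posteriorMeasure {𝓧 : Type*} (Θ : Set ℝ) (f : 𝓧 → ℝ → ℝ) (prior : ℝ → ℝ) (x : ℕ → 𝓧)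
    (n : ℕ) : Measure ℝ :=
  (volume.restrict Θ).withDensity
    (fun θ => ENNReal.ofReal (posteriorDensity Θ f prior x n θ))

/-- The posterior expectation `θ₀`. -/
def posteriorMean {𝓧 : Type*} (Θ : Set ℝ) (f : 𝓧 → ℝ → ℝ) (prior : ℝ → ℝ) (x : ℕ → 𝓧)
    (n : ℕ) : ℝ :=
  ∫ θ, θ ∂(posteriorMeasure Θ f prior x n)

/-- The posterior standard deviation `σ`. -/
def posteriorSD {𝓧 : Type*} (Θ : Set ℝ) (f : 𝓧 → ℝ → ℝ) (prior : ℝ → ℝ) (x : ℕ → 𝓧)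
    (n : ℕ) : ℝ :=
  Real.sqrt (variance (fun θ : ℝ => θ) (posteriorMeasure Θ f prior x n))

/-- The cumulants of a real random variable `X`, defined from its moments `m_k = E[X ^ k]` by
`κ_{n+1} = m_{n+1} - ∑_{k < n} (n choose k) κ_{k+1} m_{n-k}`. This is the identity
`∑ m_k t^k / k! = exp (∑ κ_k t^k / k!)` between formal power series, so that
`κ_1` is the mean, `κ_2` the variance, and so on; the cumulant of order `j` is meaningful
as soon as `X` has a finite absolute moment of order `j`. -/
def cumulant {Ω : Type*} [MeasurableSpace Ω] (X : Ω → ℝ) (μ : Measure Ω) : ℕ → ℝ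
  | 0 => 0
  | n + 1 => moment X (n + 1) μ -
      ∑ k : Fin n, (n.choose k : ℝ) * cumulant X μ (k + 1) * moment X (n - k) μ

/-- The invariant posterior cumulant of order `j`: the cumulant of order `j` of `(θ - θ₀) / σ`
under the posterior distribution. -/
def invariantCumulant {𝓧 : Type*} (Θ : Set ℝ) (f : 𝓧 → ℝ → ℝ) (prior : ℝ → ℝ) (x : ℕ → 𝓧)
    (n j : ℕ) : ℝ :=
  cumulant (fun θ : ℝ => (θ - posteriorMean Θ f prior x n) / posteriorSD Θ f prior x n)
    (posteriorMeasure Θ f prior x n) j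

end

/-! This is Laplace's method carried to third order. Put `a = -ℓ''(t₀)` at the maximizer `t₀`, `h =
(n a)^(-1/2)` and `s = (θ - t₀) / h`. Taylor's formula turns the posterior weight, normalized at
`t₀`, into `exp(-s²/2) · (1 + h (b s + A s³) + h² (e₂ s² + e₄ s⁴ + e₆ s⁶)) + O(h³)`, the error being
a polynomial in `|s|` times a Gaussian (`LaplaceRegular.local_approx`). Outside the fixed
neighborhood the weight is exponentially small against the fifth-moment weight
(`LaplaceRegular.tail`).

Parity then decides. The bracket has an odd coefficient at `h` and even ones at `1` and `h²`, so
even moments of `s` are Gaussian up to `O(h²)`, while odd moments are `h` times an explicit form in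
`A, b`, up to `O(h³)` (`exists_moment_expansion`). Division by the zeroth moment keeps this shape.

Standardized cumulants do not see the affine change from `θ` to `s`. Written in raw moments, the
third has a numerator of order `h`; in the fourth the constant term cancels, leaving `h²`; in the
fifth the whole coefficient of `h` cancels, leaving `h³` (`exists_cumulant_numerator_bound`). The
variance of `s` stays near `1`, and `c n h² ≤ 1` converts `h^(j-2)` into `n^((2-j)/2)`. All
constants depend only on `ε, δ, c, M, m, C`, hence are uniform in `n`. -/

/-! ### Taylor's formula and the remainder of the exponential -/

/-- Two-sided Taylor formula with Lagrange remainder on an open interval. -/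
lemma exists_taylor_lagrange {f : ℝ → ℝ} {t₀ ε t : ℝ} (N : ℕ)
    (hf : ContDiffOn ℝ (N + 1 : ℕ) f (Set.Ioo (t₀ - ε) (t₀ + ε)))
    (ht : t ∈ Set.Ioo (t₀ - ε) (t₀ + ε)) :
    ∃ ξ ∈ Set.uIcc t₀ t,
      f t = ∑ k ∈ Finset.range (N + 1), iteratedDeriv k f t₀ * (t - t₀) ^ k / (k.factorial : ℝ) +
        iteratedDeriv (N + 1) f ξ * (t - t₀) ^ (N + 1) / ((N + 1).factorial : ℝ) := by
  have ht₀ : t₀ ∈ Set.Ioo (t₀ - ε) (t₀ + ε) := by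
    constructor <;> linarith [ht.1, ht.2]
  rcases eq_or_ne t₀ t with rfl | hne
  · refine ⟨t₀, Set.left_mem_uIcc, ?_⟩
    rw [Finset.sum_range_succ']
    simp
  have hsub : Set.uIcc t₀ t ⊆ Set.Ioo (t₀ - ε) (t₀ + ε) :=
    (Set.ordConnected_Ioo).uIcc_subset ht₀ ht
  obtain ⟨ξ, hξ, h⟩ := taylor_mean_remainder_lagrange_iteratedDeriv (n := N) hne
    (by exact_mod_cast hf.mono hsub)
  refine ⟨ξ, Set.Ioo_subset_Icc_self hξ, ?_⟩
  rw [← h, taylor_within_apply]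
  have : ∀ k ∈ Finset.range (N + 1), (((k.factorial : ℝ)⁻¹ * (t - t₀) ^ k) •
      iteratedDerivWithin k f (Set.uIcc t₀ t) t₀) =
      iteratedDeriv k f t₀ * (t - t₀) ^ k / (k.factorial : ℝ) := by
    intro k hk
    rw [iteratedDerivWithin_eq_iteratedDeriv (uniqueDiffOn_uIcc hne) _ Set.left_mem_uIcc]
    · simp only [smul_eq_mul]; ring
    · refine (hf.contDiffAt (Ioo_mem_nhds ht₀.1 ht₀.2)).of_le ?_
      have := Finset.mem_range.1 hk
      exact_mod_cast this.le
  rw [Finset.sum_congr rfl this]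
  ring

/-- The Lagrange point lies between `0` and `u`, so its exponential is at most `1 + exp u`. No bound
on `u` is needed: multiplied by `exp (-s²/2)`, the factor `1 + exp u` becomes a Gaussian plus the
posterior weight itself, and both are dominated by a Gaussian. -/
lemma abs_exp_sub_quadratic_le (u : ℝ) :
    |Real.exp u - (1 + u + u ^ 2 / 2)| ≤ (1 + Real.exp u) * |u| ^ 3 := by
  obtain ⟨ξ, hξ, h⟩ := exists_taylor_lagrange (f := Real.exp) (t₀ := 0) (ε := |u| + 1) (t := u) 2
    Real.contDiff_exp.contDiffOn
    ⟨by linarith [neg_abs_le u], by linarith [le_abs_self u]⟩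
  have hexp : Real.exp ξ ≤ 1 + Real.exp u := by
    rcases Set.mem_uIcc.1 hξ with h' | h'
    · linarith [Real.exp_le_exp.2 h'.2]
    · linarith [Real.exp_le_one_iff.2 h'.2, Real.exp_pos u]
  have heq : Real.exp u - (1 + u + u ^ 2 / 2) = Real.exp ξ * u ^ 3 / 6 := by
    rw [h]
    simp [Finset.sum_range_succ, iteratedDeriv_eq_iterate, Nat.factorial]
  rw [heq, abs_div, abs_mul, abs_pow, Real.abs_exp, abs_of_pos (by norm_num : (0 : ℝ) < 6)]
  have : Real.exp ξ * |u| ^ 3 ≤ (1 + Real.exp u) * |u| ^ 3 := by gcongr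
  have : 0 ≤ Real.exp ξ * |u| ^ 3 := by positivity
  linarith

/-! ### Gaussian integrals and moments -/

lemma integrable_abs_pow_mul_exp {b : ℝ} (hb : 0 < b) (k : ℕ) :
    Integrable (fun s : ℝ => |s| ^ k * Real.exp (-b * s ^ 2)) := by
  have h := (integrable_rpow_mul_exp_neg_mul_sq hb (s := k)
    (by have : (0 : ℝ) ≤ k := k.cast_nonneg
        linarith)).norm
  refine h.congr (ae_of_all _ fun s => ?_)
  simp [Real.rpow_natCast]

lemma integrable_one_add_abs_pow_mul_exp {b : ℝ} (hb : 0 < b) (k : ℕ) :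
    Integrable (fun s : ℝ => (1 + |s|) ^ k * Real.exp (-b * s ^ 2)) := by
  simp_rw [add_comm (1 : ℝ), add_pow, one_pow, mul_one, Finset.sum_mul]
  refine integrable_finsetSum _ fun i _ => ?_
  refine ((integrable_abs_pow_mul_exp hb i).const_mul (k.choose i : ℝ)).congr
    (ae_of_all _ fun s => ?_)
  simp only
  ring

lemma integrable_pow_mul_gaussian (k : ℕ) :
    Integrable (fun s : ℝ => s ^ k * Real.exp (-s ^ 2 / 2)) := by
  refine ((integrable_abs_pow_mul_exp (b := 1 / 2) (by norm_num) k)).mono'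
    (by fun_prop) (ae_of_all _ fun s => ?_)
  rw [norm_mul, norm_pow, Real.norm_eq_abs, Real.norm_eq_abs, Real.abs_exp]
  apply le_of_eq
  congr 2
  ring

/-- The unnormalized moments of the standard Gaussian. -/
noncomputable def gaussMoment (k : ℕ) : ℝ := ∫ s : ℝ, s ^ k * Real.exp (-s ^ 2 / 2)

lemma gaussMoment_odd (k : ℕ) (hk : Odd k) : gaussMoment k = 0 := by
  have h := integral_neg_eq_self (fun s : ℝ => s ^ k * Real.exp (-s ^ 2 / 2)) volume
  simp only [hk.neg_pow, neg_sq, neg_mul, integral_neg] at h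
  unfold gaussMoment
  linarith

lemma gaussMoment_zero_pos : 0 < gaussMoment 0 := by
  have : gaussMoment 0 = ∫ s : ℝ, Real.exp (-(1 / 2) * s ^ 2) := by
    unfold gaussMoment
    congr 1; ext s; rw [pow_zero, one_mul]; congr 1; ring
  rw [this, integral_gaussian]
  positivity

/-- Integration by parts, with `s * exp (-s²/2)` as the derivative of `-exp (-s²/2)`. -/
lemma gaussMoment_add_two (k : ℕ) : gaussMoment (k + 2) = (k + 1) * gaussMoment k := by
  have h := integral_mul_deriv_eq_deriv_mul_of_integrable
    (u := fun s : ℝ => s ^ (k + 1)) (v := fun s => -Real.exp (-s ^ 2 / 2))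
    (u' := fun s => (k + 1) * s ^ k) (v' := fun s => s * Real.exp (-s ^ 2 / 2))
    (fun s _ => by simpa using hasDerivAt_pow (k + 1) s)
    (fun s _ => by
      have h1 : HasDerivAt (fun s : ℝ => -s ^ 2 / 2) (-s) s := by
        have := ((hasDerivAt_pow 2 s).neg.div_const 2)
        convert! this using 1
        norm_num
        ring
      convert! h1.exp.neg using 1
      ring)
    ((integrable_pow_mul_gaussian (k + 2)).congr (ae_of_all _ fun s => by simp only [Pi.mul_apply]; ring))
    (((integrable_pow_mul_gaussian k).const_mul (-(k + 1 : ℝ))).congr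
      (ae_of_all _ fun s => by simp only [Pi.mul_apply]; ring))
    ((integrable_pow_mul_gaussian (k + 1)).neg.congr
      (ae_of_all _ fun s => by simp only [Pi.mul_apply, Pi.neg_apply]; ring))
  unfold gaussMoment
  rw [← integral_const_mul]
  calc _ = ∫ s : ℝ, s ^ (k + 1) * (s * Real.exp (-s ^ 2 / 2)) := by
        congr 1; ext s; ring
    _ = _ := by
        rw [h, ← integral_neg]
        congr 1; ext s; ring

/-! ### The corrected Gaussian weight -/

/-- The Gaussian weight with its corrections of first and second order in `h`. -/
noncomputable def edgeworth (A b e₂ e₄ e₆ h s : ℝ) : ℝ :=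
  Real.exp (-s ^ 2 / 2) *
    (1 + h * (b * s + A * s ^ 3) + h ^ 2 * (e₂ * s ^ 2 + e₄ * s ^ 4 + e₆ * s ^ 6))

/-- Here `u` is the exponent beyond `-s²/2`, equal to `h P + h² Q` up to third order. Expanding `exp
u` to second order and keeping powers of `h` up to two gives `1 + h P + h² (Q + P²/2)`, whence the
coefficients. The power `15` comes from `|u|³` with `|u| = O(h (1 + |s|)⁵)`. -/
lemma abs_exp_mul_sub_edgeworth_le {K K₁ A B b d h s u ρ : ℝ} (hK : 0 ≤ K)
    (hA : |A| ≤ K) (hB : |B| ≤ K) (hb : |b| ≤ K) (hd : |d| ≤ K) (h0 : 0 < h) (h1 : h ≤ 1)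
    (hu : |u - h * (b * s + A * s ^ 3) - h ^ 2 * (d * s ^ 2 + B * s ^ 4)| ≤
      K * h ^ 3 * (1 + |s|) ^ 5)
    (hexp : Real.exp (-s ^ 2 / 2) * (1 + Real.exp u) ≤ K₁ * Real.exp (-ρ * s ^ 2)) :
    |Real.exp (-s ^ 2 / 2 + u) - edgeworth A b (d + b ^ 2 / 2) (B + b * A) (A ^ 2 / 2) h s| ≤
      K₁ * (K + 21 * K ^ 2 + 125 * K ^ 3) * h ^ 3 * (1 + |s|) ^ 15 * Real.exp (-ρ * s ^ 2) := by
  set y := 1 + |s| with hy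
  have hs0 := abs_nonneg s
  have hy1 : 1 ≤ y := by linarith
  have hsy : |s| ≤ y := by linarith
  have hpow : ∀ i j : ℕ, i ≤ j → y ^ i ≤ y ^ j := fun i j hij => pow_le_pow_right₀ hy1 hij
  have hmono : ∀ (c : ℝ) (i : ℕ), |c| ≤ K → i ≤ 5 → |c * s ^ i| ≤ K * y ^ 5 := by
    intro c i hc hi
    rw [abs_mul, abs_pow]
    exact mul_le_mul hc ((pow_le_pow_left₀ hs0 hsy i).trans (hpow i 5 hi)) (by positivity) hK
  have hP : |b * s + A * s ^ 3| ≤ 2 * K * y ^ 5 := by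
    have h₁ := hmono b 1 hb (by norm_num)
    have h₂ := hmono A 3 hA (by norm_num)
    rw [pow_one] at h₁
    linarith [abs_add_le (b * s) (A * s ^ 3)]
  have hQ : |d * s ^ 2 + B * s ^ 4| ≤ 2 * K * y ^ 5 := by
    have h₁ := hmono d 2 hd (by norm_num)
    have h₂ := hmono B 4 hB (by norm_num)
    linarith [abs_add_le (d * s ^ 2) (B * s ^ 4)]
  set P := b * s + A * s ^ 3 with hPdef
  set Q := d * s ^ 2 + B * s ^ 4 with hQdef
  have hh2 : h ^ 2 ≤ h := by nlinarith
  have hh3 : h ^ 3 ≤ h ^ 2 := by nlinarith [sq_nonneg h]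
  have hKy : 0 ≤ K * y ^ 5 := by positivity
  have hdiff : |u - h * P| ≤ 3 * K * h ^ 2 * y ^ 5 := by
    have e : u - h * P = (u - h * P - h ^ 2 * Q) + h ^ 2 * Q := by ring
    have h₁ : |h ^ 2 * Q| ≤ h ^ 2 * (2 * K * y ^ 5) := by
      rw [abs_mul, abs_of_pos (by positivity : 0 < h ^ 2)]; gcongr
    have h₂ : K * h ^ 3 * y ^ 5 ≤ K * h ^ 2 * y ^ 5 := by gcongr
    rw [e]
    refine (abs_add_le _ _).trans ?_
    linarith
  have hhP : |h * P| ≤ h * (2 * K * y ^ 5) := by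
    rw [abs_mul, abs_of_pos h0]; gcongr
  have h3' : 3 * K * h ^ 2 * y ^ 5 ≤ 3 * K * h * y ^ 5 := by gcongr
  have huabs : |u| ≤ 5 * K * h * y ^ 5 := by
    have e : u = (u - h * P) + h * P := by ring
    rw [e]
    refine (abs_add_le _ _).trans ?_
    linarith
  have hsum : |u + h * P| ≤ 7 * K * h * y ^ 5 := by
    refine (abs_add_le _ _).trans ?_
    linarith
  have hsq : |u ^ 2 - (h * P) ^ 2| ≤ 21 * K ^ 2 * h ^ 3 * y ^ 10 := by
    have e : u ^ 2 - (h * P) ^ 2 = (u - h * P) * (u + h * P) := by ring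
    rw [e, abs_mul]
    calc _ ≤ (3 * K * h ^ 2 * y ^ 5) * (7 * K * h * y ^ 5) := by gcongr
      _ = _ := by ring
  have hcube : |u| ^ 3 ≤ 125 * K ^ 3 * h ^ 3 * y ^ 15 := by
    calc |u| ^ 3 ≤ (5 * K * h * y ^ 5) ^ 3 := by gcongr
      _ = _ := by ring
  have hE := abs_exp_sub_quadratic_le u
  have hu1 : 1 ≤ 1 + Real.exp u := by linarith [Real.exp_pos u]
  have key : |Real.exp u - (1 + h * P + h ^ 2 * ((d + b ^ 2 / 2) * s ^ 2 + (B + b * A) * s ^ 4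
      + A ^ 2 / 2 * s ^ 6))| ≤
      (1 + Real.exp u) * ((K + 21 * K ^ 2 + 125 * K ^ 3) * h ^ 3 * y ^ 15) := by
    -- Three errors of order `h³`: the exponential remainder, the error in `u`, and the replacement
    -- of `u²` by `(h P)²`.
    have e : Real.exp u - (1 + h * P + h ^ 2 * ((d + b ^ 2 / 2) * s ^ 2 + (B + b * A) * s ^ 4
      + A ^ 2 / 2 * s ^ 6)) = (Real.exp u - (1 + u + u ^ 2 / 2)) +
        (u - h * P - h ^ 2 * Q) + (u ^ 2 - (h * P) ^ 2) / 2 := by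
      rw [hPdef, hQdef]; ring
    have h₅ : K * h ^ 3 * y ^ 5 ≤ K * h ^ 3 * y ^ 15 := by gcongr; norm_num
    have h₁₀ : 21 * K ^ 2 * h ^ 3 * y ^ 10 ≤ 21 * K ^ 2 * h ^ 3 * y ^ 15 := by gcongr; norm_num
    have t₁ : (1 + Real.exp u) * |u| ^ 3 ≤ (1 + Real.exp u) * (125 * K ^ 3 * h ^ 3 * y ^ 15) := by
      gcongr
    have t₂ : K * h ^ 3 * y ^ 15 + 21 * K ^ 2 * h ^ 3 * y ^ 15 ≤
        (1 + Real.exp u) * (K * h ^ 3 * y ^ 15 + 21 * K ^ 2 * h ^ 3 * y ^ 15) :=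
      le_mul_of_one_le_left (by positivity) hu1
    have hhalf : |(u ^ 2 - (h * P) ^ 2) / 2| ≤ |u ^ 2 - (h * P) ^ 2| := by
      rw [abs_div, abs_two]
      linarith [abs_nonneg (u ^ 2 - (h * P) ^ 2)]
    rw [e]
    refine (abs_add_three _ _ _).trans ?_
    linarith
  unfold edgeworth
  rw [Real.exp_add, ← mul_sub, abs_mul, Real.abs_exp]
  calc _ ≤ Real.exp (-s ^ 2 / 2) * ((1 + Real.exp u) *
        ((K + 21 * K ^ 2 + 125 * K ^ 3) * h ^ 3 * y ^ 15)) := by gcongr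
    _ = (Real.exp (-s ^ 2 / 2) * (1 + Real.exp u)) *
        ((K + 21 * K ^ 2 + 125 * K ^ 3) * h ^ 3 * y ^ 15) := by ring
    _ ≤ (K₁ * Real.exp (-ρ * s ^ 2)) * ((K + 21 * K ^ 2 + 125 * K ^ 3) * h ^ 3 * y ^ 15) := by
        gcongr
    _ = _ := by ring

/-- Away from the mode the corrected Gaussian weight is negligible. -/
lemma abs_edgeworth_le_of_le {K A b e₂ e₄ e₆ h s ε ρ : ℝ} (hA : |A| ≤ K) (hb : |b| ≤ K)
    (h₂ : |e₂| ≤ K) (h₄ : |e₄| ≤ K) (h₆ : |e₆| ≤ K) (h0 : 0 < h) (h1 : h ≤ 1) (hε : 0 < ε)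
    (hρ : ρ ≤ 1 / 2) (hs : ε ≤ h * |s|) :
    |edgeworth A b e₂ e₄ e₆ h s| ≤
      (1 + 5 * K) / ε ^ 3 * h ^ 3 * (1 + |s|) ^ 15 * Real.exp (-ρ * s ^ 2) := by
  have hK : 0 ≤ K := (abs_nonneg _).trans hA
  set y := 1 + |s| with hy
  have hs0 := abs_nonneg s
  have hy1 : 1 ≤ y := by linarith
  have hsy : |s| ≤ y := by linarith
  have hmono : ∀ (c : ℝ) (i : ℕ), |c| ≤ K → i ≤ 6 → |c * s ^ i| ≤ K * y ^ 6 := by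
    intro c i hc hi
    rw [abs_mul, abs_pow]
    exact mul_le_mul hc ((pow_le_pow_left₀ hs0 hsy i).trans (pow_le_pow_right₀ hy1 hi))
      (by positivity) hK
  have hP : |h * (b * s + A * s ^ 3)| ≤ 2 * K * y ^ 6 := by
    have t₁ := hmono b 1 hb (by norm_num)
    have t₂ := hmono A 3 hA (by norm_num)
    rw [pow_one] at t₁
    rw [abs_mul, abs_of_pos h0]
    refine (mul_le_of_le_one_left (abs_nonneg _) h1).trans ?_
    linarith [abs_add_le (b * s) (A * s ^ 3)]
  have hQ : |h ^ 2 * (e₂ * s ^ 2 + e₄ * s ^ 4 + e₆ * s ^ 6)| ≤ 3 * K * y ^ 6 := by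
    have t₁ := hmono e₂ 2 h₂ (by norm_num)
    have t₂ := hmono e₄ 4 h₄ (by norm_num)
    have t₃ := hmono e₆ 6 h₆ (by norm_num)
    rw [abs_mul, abs_of_pos (by positivity)]
    refine (mul_le_of_le_one_left (abs_nonneg _) (pow_le_one₀ h0.le h1)).trans ?_
    linarith [abs_add_three (e₂ * s ^ 2) (e₄ * s ^ 4) (e₆ * s ^ 6)]
  have hfac : |1 + h * (b * s + A * s ^ 3) + h ^ 2 * (e₂ * s ^ 2 + e₄ * s ^ 4 + e₆ * s ^ 6)| ≤
      (1 + 5 * K) * y ^ 6 := by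
    refine (abs_add_three _ _ _).trans ?_
    have : 1 ≤ y ^ 6 := one_le_pow₀ hy1
    rw [abs_one]
    linarith
  -- At distance at least `ε` from the mode, `h * y / ε` is at least `1`; its cube supplies the
  -- factor `h³`.
  have hone : 1 ≤ (h * y / ε) ^ 3 := by
    apply one_le_pow₀
    rw [le_div_iff₀ hε, one_mul]
    exact hs.trans (by gcongr)
  have hex : Real.exp (-s ^ 2 / 2) ≤ Real.exp (-ρ * s ^ 2) := by
    apply Real.exp_le_exp.2
    nlinarith [sq_nonneg s]
  unfold edgeworth
  rw [abs_mul, Real.abs_exp]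
  calc _ ≤ Real.exp (-ρ * s ^ 2) * ((1 + 5 * K) * y ^ 6) := by gcongr
    _ ≤ Real.exp (-ρ * s ^ 2) * ((1 + 5 * K) * y ^ 6) * (h * y / ε) ^ 3 :=
        le_mul_of_one_le_right (by positivity) hone
    _ = Real.exp (-ρ * s ^ 2) * ((1 + 5 * K) / ε ^ 3 * h ^ 3 * y ^ 9) := by
        field_simp
    _ ≤ Real.exp (-ρ * s ^ 2) * ((1 + 5 * K) / ε ^ 3 * h ^ 3 * y ^ 15) := by
        gcongr
        norm_num
    _ = _ := by ring

/-! ### Local expansion of loglikelihood and log prior -/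

/-- Near a strict curvature maximum, with derivatives bounded by `M`, a function is controlled by
its Taylor polynomial of order four. -/
lemma loglik_taylor {l : ℝ → ℝ} {t₀ ε c M : ℝ} (hε : 0 < ε) (hc : 0 < c)
    (hl : ContDiffOn ℝ 6 l (Set.Ioo (t₀ - ε) (t₀ + ε)))
    (hmax : ∀ θ ∈ Set.Ioo (t₀ - ε) (t₀ + ε), l θ ≤ l t₀)
    (hbound : ∀ j ∈ Finset.Icc 2 6, ∀ θ ∈ Set.Ioo (t₀ - ε) (t₀ + ε), |iteratedDeriv j l θ| ≤ M)
    (hcurv : ∀ θ ∈ Set.Ioo (t₀ - ε) (t₀ + ε), c ≤ |iteratedDeriv 2 l θ|) :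
    ∃ a l₃ l₄ : ℝ, c ≤ a ∧ a ≤ M ∧ |l₃| ≤ M ∧ |l₄| ≤ M ∧
      ∀ θ ∈ Set.Ioo (t₀ - ε) (t₀ + ε), l θ - l t₀ ≤ -(c / 2) * (θ - t₀) ^ 2 ∧
        |l θ - l t₀ + a * (θ - t₀) ^ 2 / 2 - l₃ * (θ - t₀) ^ 3 / 6 - l₄ * (θ - t₀) ^ 4 / 24| ≤
          M * |θ - t₀| ^ 5 := by
  set I := Set.Ioo (t₀ - ε) (t₀ + ε) with hI
  have ht₀ : t₀ ∈ I := ⟨by linarith, by linarith⟩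
  have hsub : ∀ {θ ξ : ℝ}, θ ∈ I → ξ ∈ Set.uIcc t₀ θ → ξ ∈ I := fun hθ hξ =>
    Set.ordConnected_Ioo.uIcc_subset ht₀ hθ hξ
  have hderiv : iteratedDeriv 1 l t₀ = 0 := by
    rw [iteratedDeriv_one]
    exact IsLocalMax.deriv_eq_zero (Filter.mem_of_superset (Ioo_mem_nhds ht₀.1 ht₀.2) hmax)
  have hT1 : ∀ θ ∈ I, ∃ ξ ∈ I, l θ - l t₀ = iteratedDeriv 2 l ξ * (θ - t₀) ^ 2 / 2 := by
    intro θ hθ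
    obtain ⟨ξ, hξ, h⟩ := exists_taylor_lagrange 1 (hl.of_le (by norm_num)) hθ
    refine ⟨ξ, hsub hθ hξ, ?_⟩
    rw [h]
    simp [Finset.sum_range_succ, hderiv]
  have hcont : ContinuousOn (iteratedDeriv 2 l) I := by
    have h1 := hl.continuousOn_iteratedDerivWithin (m := 2) (by norm_num) isOpen_Ioo.uniqueDiffOn
    exact h1.congr fun θ hθ => (iteratedDerivWithin_of_isOpen isOpen_Ioo hθ).symm
  -- Only `|ℓ''|` is bounded below. By continuity `ℓ''` cannot change sign without vanishing, and a
  -- positive sign throughout would contradict the maximum at `t₀`.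
  have hneg : ∀ θ ∈ I, iteratedDeriv 2 l θ ≤ -c := by
    by_contra! hcon
    obtain ⟨θ₁, hθ₁, h₁⟩ := hcon
    have hpos₁ : 0 < iteratedDeriv 2 l θ₁ := by
      by_contra! hle
      have := hcurv θ₁ hθ₁
      rw [abs_of_nonpos hle] at this
      linarith
    have hpos : ∀ θ ∈ I, 0 < iteratedDeriv 2 l θ := by
      intro θ hθ
      by_contra! hle
      obtain ⟨ξ, hξ, h0⟩ := isPreconnected_Ioo.intermediate_value hθ hθ₁ hcont
        (show (0 : ℝ) ∈ Set.Icc _ _ from ⟨hle, hpos₁.le⟩)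
      have := hcurv ξ hξ
      rw [h0, abs_zero] at this
      linarith
    have hθ₂ : t₀ + ε / 2 ∈ I := ⟨by linarith, by linarith⟩
    obtain ⟨ξ, hξ, h⟩ := hT1 _ hθ₂
    have h2 := hmax _ hθ₂
    have h3 : 0 < iteratedDeriv 2 l ξ * (t₀ + ε / 2 - t₀) ^ 2 / 2 := by
      have := hpos ξ hξ
      have : t₀ + ε / 2 - t₀ = ε / 2 := by ring
      rw [this]
      positivity
    linarith
  refine ⟨-iteratedDeriv 2 l t₀, iteratedDeriv 3 l t₀, iteratedDeriv 4 l t₀, by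
    linarith [hneg t₀ ht₀], ?_, hbound 3 (by simp) _ ht₀, hbound 4 (by simp) _ ht₀, ?_⟩
  · exact (neg_le_abs _).trans (hbound 2 (by simp) _ ht₀)
  intro θ hθ
  constructor
  · obtain ⟨ξ, hξ, h⟩ := hT1 θ hθ
    rw [h]
    nlinarith [hneg ξ hξ, sq_nonneg (θ - t₀)]
  · obtain ⟨ξ, hξ, h⟩ := exists_taylor_lagrange 4 (hl.of_le (by norm_num)) hθ
    have e : l θ - l t₀ + -iteratedDeriv 2 l t₀ * (θ - t₀) ^ 2 / 2 -
        iteratedDeriv 3 l t₀ * (θ - t₀) ^ 3 / 6 - iteratedDeriv 4 l t₀ * (θ - t₀) ^ 4 / 24 =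
        iteratedDeriv 5 l ξ * (θ - t₀) ^ 5 / 120 := by
      rw [h]
      simp [Finset.sum_range_succ, hderiv, Nat.factorial]
      ring
    rw [e, abs_div, abs_mul, abs_pow]
    have hb := hbound 5 (by simp) ξ (hsub hθ hξ)
    have : |iteratedDeriv 5 l ξ| * |θ - t₀| ^ 5 ≤ M * |θ - t₀| ^ 5 := by gcongr
    have h0 : 0 ≤ |iteratedDeriv 5 l ξ| * |θ - t₀| ^ 5 := by positivity
    rw [abs_of_pos (by norm_num : (0 : ℝ) < 120)]
    linarith

lemma taylor_two_bound {q : ℝ → ℝ} {t₀ ε M : ℝ} (hε : 0 < ε)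
    (hq : ContDiffOn ℝ 6 q (Set.Ioo (t₀ - ε) (t₀ + ε)))
    (hbound : ∀ j ∈ Finset.Icc 0 6, ∀ θ ∈ Set.Ioo (t₀ - ε) (t₀ + ε), |iteratedDeriv j q θ| ≤ M) :
    ∃ q₁ q₂ : ℝ, |q₁| ≤ M ∧ |q₂| ≤ M ∧ ∀ θ ∈ Set.Ioo (t₀ - ε) (t₀ + ε),
      |q θ - q t₀ - q₁ * (θ - t₀) - q₂ * (θ - t₀) ^ 2 / 2| ≤ M * |θ - t₀| ^ 3 := by
  have ht₀ : t₀ ∈ Set.Ioo (t₀ - ε) (t₀ + ε) := ⟨by linarith, by linarith⟩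
  refine ⟨iteratedDeriv 1 q t₀, iteratedDeriv 2 q t₀, hbound 1 (by simp) _ ht₀,
    hbound 2 (by simp) _ ht₀, fun θ hθ => ?_⟩
  obtain ⟨ξ, hξ, h⟩ := exists_taylor_lagrange 2 (hq.of_le (by norm_num)) hθ
  have e : q θ - q t₀ - iteratedDeriv 1 q t₀ * (θ - t₀) - iteratedDeriv 2 q t₀ * (θ - t₀) ^ 2 / 2
      = iteratedDeriv 3 q ξ * (θ - t₀) ^ 3 / 6 := by
    rw [h]
    simp [Finset.sum_range_succ, Nat.factorial]
    ring
  rw [e, abs_div, abs_mul, abs_pow]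
  have hb := hbound 3 (by simp) ξ (Set.ordConnected_Ioo.uIcc_subset ht₀ hθ hξ)
  have : |iteratedDeriv 3 q ξ| * |θ - t₀| ^ 3 ≤ M * |θ - t₀| ^ 3 := by gcongr
  have h0 : 0 ≤ |iteratedDeriv 3 q ξ| * |θ - t₀| ^ 3 := by positivity
  rw [abs_of_pos (by norm_num : (0 : ℝ) < 6)]
  linarith

/-- Since `n * a * h² = 1`, the substitution `t = h s` turns the quadratic term into `-s²/2`, the
cubic and quartic ones into terms of order `h` and `h²`, and both Taylor remainders into `O(h³)`. -/
lemma abs_local_weight_sub_edgeworth_le {a c M n h t G Q l₃ l₄ q₁ q₂ : ℝ}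
    (hc : 0 < c) (hca : c ≤ a) (haM : a ≤ M) (h₃ : |l₃| ≤ M) (h₄ : |l₄| ≤ M) (hq₁ : |q₁| ≤ M)
    (hq₂ : |q₂| ≤ M) (h0 : 0 < h) (h1 : h ≤ 1) (hn : n * a * h ^ 2 = 1)
    (hG : |G + a * t ^ 2 / 2 - l₃ * t ^ 3 / 6 - l₄ * t ^ 4 / 24| ≤ M * |t| ^ 5)
    (hG' : G ≤ -(c / 2) * t ^ 2)
    (hQ : |Q - q₁ * t - q₂ * t ^ 2 / 2| ≤ M * |t| ^ 3) (hQ' : Q ≤ 2 * M) :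
    |Real.exp (n * G + Q) - edgeworth (l₃ / (6 * a)) q₁ (q₂ / 2 + q₁ ^ 2 / 2)
        (l₄ / (24 * a) + q₁ * (l₃ / (6 * a))) ((l₃ / (6 * a)) ^ 2 / 2) h (t / h)| ≤
      (1 + Real.exp (2 * M)) * ((M + M / c) + 21 * (M + M / c) ^ 2 + 125 * (M + M / c) ^ 3) * h ^ 3 *
        (1 + |t / h|) ^ 15 * Real.exp (-(c / (2 * M)) * (t / h) ^ 2) := by
  have ha : 0 < a := hc.trans_le hca
  have hM : 0 < M := ha.trans_le haM
  have hMc : 0 < M / c := by positivity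
  set s := t / h with hs
  have hts : t = h * s := by rw [hs]; field_simp
  have hna : n = 1 / (a * h ^ 2) := by
    field_simp
    linarith
  have hn0 : 0 < n := by rw [hna]; positivity
  have hdiv : ∀ (x k : ℝ), |x| ≤ M → 1 ≤ k → |x / (k * a)| ≤ M + M / c := by
    intro x k hx hk
    rw [abs_div, abs_of_pos (by positivity : 0 < k * a)]
    have : |x| / (k * a) ≤ M / c := by
      gcongr
      nlinarith
    linarith
  have hexp_eq : n * G + Q = -s ^ 2 / 2 + (n * G + Q + s ^ 2 / 2) := by ring
  rw [hexp_eq]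
  refine abs_exp_mul_sub_edgeworth_le (by positivity) (hdiv _ _ h₃ (by norm_num))
    (hdiv _ _ h₄ (by norm_num)) (by linarith) ?_ h0 h1 ?_ ?_
  · rw [abs_div, abs_two]
    linarith [abs_nonneg q₂]
  · have e : n * G + Q + s ^ 2 / 2 - h * (q₁ * s + l₃ / (6 * a) * s ^ 3) -
        h ^ 2 * (q₂ / 2 * s ^ 2 + l₄ / (24 * a) * s ^ 4) =
        n * (G + a * t ^ 2 / 2 - l₃ * t ^ 3 / 6 - l₄ * t ^ 4 / 24) +
        (Q - q₁ * t - q₂ * t ^ 2 / 2) := by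
      rw [hts, hna]
      field_simp
      ring
    have hs0 := abs_nonneg s
    have t₁ : |n * (G + a * t ^ 2 / 2 - l₃ * t ^ 3 / 6 - l₄ * t ^ 4 / 24)| ≤
        M / c * h ^ 3 * (1 + |s|) ^ 5 := by
      rw [abs_mul, abs_of_pos hn0]
      calc _ ≤ n * (M * |t| ^ 5) := by gcongr
        _ = M / a * h ^ 3 * |s| ^ 5 := by
            rw [hts, hna, abs_mul, abs_of_pos h0]
            field_simp
        _ ≤ _ := by gcongr; linarith
    have t₂ : |Q - q₁ * t - q₂ * t ^ 2 / 2| ≤ M * h ^ 3 * (1 + |s|) ^ 5 := by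
      refine hQ.trans ?_
      rw [hts, abs_mul, abs_of_pos h0]
      calc M * (h * |s|) ^ 3 = M * h ^ 3 * |s| ^ 3 := by ring
        _ ≤ M * h ^ 3 * (1 + |s|) ^ 3 := by gcongr; linarith
        _ ≤ _ := by
          gcongr
          · linarith
          · norm_num
    rw [e]
    refine (abs_add_le _ _).trans ?_
    linarith
  -- The summands are the Gaussian and the weight itself. The quadratic bound on `G` gives the
  -- weight the rate `c / (2a)`; as `c ≤ a ≤ M`, the rate `c / (2M)` serves for both.
  · rw [mul_add, ← Real.exp_add, ← hexp_eq, mul_one, add_mul, one_mul]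
    have hρ : c / (2 * M) ≤ 1 / 2 := by
      rw [div_le_div_iff₀ (by positivity) (by norm_num)]
      linarith
    gcongr
    · nlinarith [sq_nonneg s]
    · rw [← Real.exp_add]
      apply Real.exp_le_exp.2
      have : n * G ≤ n * (-(c / 2) * t ^ 2) := by gcongr
      have h5 : n * (-(c / 2) * t ^ 2) = -(c / (2 * a) * s ^ 2) := by
        rw [hts, hna]
        field_simp
      have h6 : c / (2 * M) * s ^ 2 ≤ c / (2 * a) * s ^ 2 := by gcongr
      linarith

/-! ### Moments of the corrected Gaussian and rescaling -/

lemma pow_mul_edgeworth_eq (A b e₂ e₄ e₆ h : ℝ) (k : ℕ) :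
    (fun y => y ^ k * edgeworth A b e₂ e₄ e₆ h y) = fun y =>
      y ^ k * Real.exp (-y ^ 2 / 2) + (h * b * (y ^ (k + 1) * Real.exp (-y ^ 2 / 2)) +
      (h * A * (y ^ (k + 3) * Real.exp (-y ^ 2 / 2)) +
      (h ^ 2 * e₂ * (y ^ (k + 2) * Real.exp (-y ^ 2 / 2)) +
      (h ^ 2 * e₄ * (y ^ (k + 4) * Real.exp (-y ^ 2 / 2)) +
      h ^ 2 * e₆ * (y ^ (k + 6) * Real.exp (-y ^ 2 / 2)))))) := by
  ext y
  unfold edgeworth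
  ring

lemma integrable_pow_mul_edgeworth (A b e₂ e₄ e₆ h : ℝ) (k : ℕ) :
    Integrable (fun y => y ^ k * edgeworth A b e₂ e₄ e₆ h y) := by
  rw [pow_mul_edgeworth_eq]
  have I := fun j (r : ℝ) => (integrable_pow_mul_gaussian j).const_mul r
  exact (integrable_pow_mul_gaussian k).add ((I _ _).add ((I _ _).add ((I _ _).add
    ((I _ _).add (I _ _)))))

lemma integral_pow_mul_edgeworth (A b e₂ e₄ e₆ h : ℝ) (k : ℕ) :
    ∫ y, y ^ k * edgeworth A b e₂ e₄ e₆ h y =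
      gaussMoment k + h * (b * gaussMoment (k + 1) + A * gaussMoment (k + 3)) +
      h ^ 2 * (e₂ * gaussMoment (k + 2) + e₄ * gaussMoment (k + 4) + e₆ * gaussMoment (k + 6)) := by
  have I : ∀ (j : ℕ) (r : ℝ), Integrable (fun y : ℝ => r * (y ^ j * Real.exp (-y ^ 2 / 2))) ∧
      ∫ y : ℝ, r * (y ^ j * Real.exp (-y ^ 2 / 2)) = r * gaussMoment j := fun j r =>
    ⟨(integrable_pow_mul_gaussian j).const_mul r, by rw [integral_const_mul, gaussMoment]⟩
  -- Integrability and value travel together, so each application of `integral_add` has its side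
  -- conditions at hand.
  have add : ∀ {f g : ℝ → ℝ} {u v : ℝ}, (Integrable f ∧ ∫ y, f y = u) →
      (Integrable g ∧ ∫ y, g y = v) →
      (Integrable (fun y => f y + g y) ∧ ∫ y, (f y + g y) = u + v) := fun hf hg =>
    ⟨hf.1.add hg.1, by rw [integral_add hf.1 hg.1, hf.2, hg.2]⟩
  have h0 := add (I k 1) (add (I (k + 1) (h * b)) (add (I (k + 3) (h * A))
    (add (I (k + 2) (h ^ 2 * e₂)) (add (I (k + 4) (h ^ 2 * e₄)) (I (k + 6) (h ^ 2 * e₆))))))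
  simp only [one_mul] at h0
  rw [pow_mul_edgeworth_eq, h0.2]
  ring

lemma integrable_comp_sub_div {g : ℝ → ℝ} (hg : Integrable g) (t₀ : ℝ) {h : ℝ} (h0 : 0 < h) :
    Integrable (fun θ => g ((θ - t₀) / h)) :=
  (hg.comp_div h0.ne').comp_sub_right t₀

lemma integral_comp_sub_div (g : ℝ → ℝ) (t₀ : ℝ) {h : ℝ} (h0 : 0 < h) :
    ∫ θ, g ((θ - t₀) / h) = h * ∫ y, g y := by
  rw [integral_sub_right_eq_self (fun x => g (x / h)) t₀, Measure.integral_comp_div, smul_eq_mul,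
    abs_of_pos h0]

/-- The factor `h⁻¹` cancels the Jacobian of `θ = t₀ + h s`. Multiplying the pointwise error by
`|s|^k ≤ (1 + |s|)⁵` raises the power from `15` to `20`, still integrable against the Gaussian. -/
lemma scaled_moment_of_approx {w D : ℝ → ℝ} {S : Set ℝ} {t₀ h K ρ : ℝ} (hS : MeasurableSet S)
    (hw : Measurable w) (h0 : 0 < h) (hρ : 0 < ρ)
    (hD : ∀ k, Integrable (fun y => y ^ k * D y))
    (happ : ∀ θ, |S.indicator w θ - D ((θ - t₀) / h)| ≤
      K * (1 + |(θ - t₀) / h|) ^ 15 * Real.exp (-ρ * ((θ - t₀) / h) ^ 2)) (k : ℕ) (hk : k ≤ 5) :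
    IntegrableOn (fun θ => ((θ - t₀) / h) ^ k * w θ) S ∧
    |h⁻¹ * (∫ θ in S, ((θ - t₀) / h) ^ k * w θ) - ∫ y, y ^ k * D y| ≤
      K * ∫ y, (1 + |y|) ^ 20 * Real.exp (-ρ * y ^ 2) := by
  set F : ℝ → ℝ := fun θ => ((θ - t₀) / h) ^ k * S.indicator w θ with hF
  have hFeq : F = S.indicator (fun θ => ((θ - t₀) / h) ^ k * w θ) := by
    ext θ
    by_cases hθ : θ ∈ S <;> simp [hF, hθ]
  have hDi := integrable_comp_sub_div (hD k) t₀ h0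
  have hEi := (integrable_comp_sub_div (integrable_one_add_abs_pow_mul_exp hρ 20) t₀ h0).const_mul K
  have hb : ∀ θ, ‖F θ - ((θ - t₀) / h) ^ k * D ((θ - t₀) / h)‖ ≤
      K * ((1 + |(θ - t₀) / h|) ^ 20 * Real.exp (-ρ * ((θ - t₀) / h) ^ 2)) := by
    intro θ
    set s := (θ - t₀) / h
    have hs0 := abs_nonneg s
    have hs : |s| ^ k ≤ (1 + |s|) ^ 5 :=
      (pow_le_pow_left₀ hs0 (by linarith) k).trans (pow_le_pow_right₀ (by linarith) hk)
    rw [hF, ← mul_sub, norm_mul, norm_pow, Real.norm_eq_abs, Real.norm_eq_abs]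
    calc _ ≤ (1 + |s|) ^ 5 * (K * (1 + |s|) ^ 15 * Real.exp (-ρ * s ^ 2)) :=
          mul_le_mul hs (happ θ) (abs_nonneg _) (by positivity)
      _ = _ := by ring
  have hFm : Measurable F := by
    have := hw.indicator hS
    rw [hF]
    fun_prop
  have hdi : Integrable (fun θ => F θ - ((θ - t₀) / h) ^ k * D ((θ - t₀) / h)) :=
    hEi.mono' (hFm.aestronglyMeasurable.sub hDi.aestronglyMeasurable) (ae_of_all _ hb)
  have hFi : Integrable F := by
    refine (hdi.add hDi).congr (ae_of_all _ fun θ => ?_)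
    simp
  constructor
  · rw [← integrable_indicator_iff hS, ← hFeq]
    exact hFi
  · have e1 : ∫ θ in S, ((θ - t₀) / h) ^ k * w θ = ∫ θ, F θ := by
      rw [hFeq, integral_indicator hS]
    have e2 := integral_comp_sub_div (fun y => y ^ k * D y) t₀ h0
    have e3 := integral_comp_sub_div (fun y => (1 + |y|) ^ 20 * Real.exp (-ρ * y ^ 2)) t₀ h0
    have e4 := norm_integral_le_of_norm_le hEi (ae_of_all _ hb)
    rw [integral_sub hFi hDi, e2, integral_const_mul, e3, Real.norm_eq_abs] at e4
    rw [e1]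
    have e5 : h⁻¹ * (∫ θ, F θ) - ∫ y, y ^ k * D y = h⁻¹ * ((∫ θ, F θ) - h * ∫ y, y ^ k * D y) := by
      field_simp
    rw [e5, abs_mul, abs_of_pos (inv_pos.2 h0), inv_mul_le_iff₀ h0]
    linarith

/-! ### Laplace approximation at a fixed sample size -/

/-- The hypotheses on likelihood and prior for a fixed sample size `n`. -/
structure LaplaceRegular (Θ : Set ℝ) (lik prior : ℝ → ℝ) (t₀ : ℝ) (n : ℕ) (ε δ c M m C : ℝ) :
    Prop where
  measurableSet : MeasurableSet Θ
  measurable_lik : Measurable lik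
  lik_nonneg : ∀ θ ∈ Θ, 0 ≤ lik θ
  measurable_prior : Measurable prior
  prior_nonneg : ∀ θ ∈ Θ, 0 ≤ prior θ
  nhd : ∀ θ ∈ Set.Ioo (t₀ - ε) (t₀ + ε), θ ∈ Θ ∧ 0 < lik θ ∧ 0 < prior θ
  max : ∀ θ ∈ Θ, θ ≠ t₀ → lik θ < lik t₀
  smooth : ContDiffOn ℝ 6 (fun θ => Real.log (lik θ) / n) (Set.Ioo (t₀ - ε) (t₀ + ε))
  bound : ∀ j ∈ Finset.Icc 2 6, ∀ θ ∈ Set.Ioo (t₀ - ε) (t₀ + ε),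
    |iteratedDeriv j (fun θ => Real.log (lik θ) / n) θ| ≤ M
  prior_smooth : ContDiffOn ℝ 6 (fun θ => Real.log (prior θ)) (Set.Ioo (t₀ - ε) (t₀ + ε))
  prior_bound : ∀ j ∈ Finset.Icc 0 6, ∀ θ ∈ Set.Ioo (t₀ - ε) (t₀ + ε),
    |iteratedDeriv j (fun θ => Real.log (prior θ)) θ| ≤ M
  sep : ∀ θ ∈ Θ, θ ∉ Set.Ioo (t₀ - ε) (t₀ + ε) → 0 < lik θ →
    Real.log (lik θ) / n < Real.log (lik t₀) / n - δ
  curv : ∀ θ ∈ Set.Ioo (t₀ - ε) (t₀ + ε), c ≤ |iteratedDeriv 2 (fun θ => Real.log (lik θ) / n) θ|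
  moment_integrable : IntegrableOn
    (fun θ => |θ - t₀| ^ 5 * prior θ * (lik θ / lik t₀) ^ (m / (n : ℝ))) Θ volume
  moment_le : ∫ θ in Θ, |θ - t₀| ^ 5 * prior θ * (lik θ / lik t₀) ^ (m / (n : ℝ)) ≤ C

/-- For `L > 0` the ratio splits into its powers `1 - m/n` and `m/n`: separation makes the first
exponentially small, and the second is the weight of the moment hypothesis. -/
lemma ratio_le_of_sep {L L₀ δ m n : ℝ} (hL : 0 ≤ L) (hL₀ : 0 < L₀) (hmn : m ≤ n)
    (hn : 0 < n) (hsep : 0 < L → Real.log L / n < Real.log L₀ / n - δ) :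
    L / L₀ ≤ Real.exp (-δ * (n - m)) * (L / L₀) ^ (m / n) := by
  rcases hL.eq_or_lt with h0 | hpos
  · rw [← h0, zero_div]
    positivity
  have hr : 0 < L / L₀ := by positivity
  have hlog : Real.log (L / L₀) ≤ -δ * n := by
    have h1 := hsep hpos
    rw [Real.log_div hpos.ne' hL₀.ne']
    rw [div_lt_iff₀ hn, sub_mul, div_mul_cancel₀ _ hn.ne'] at h1
    linarith
  rw [Real.rpow_def_of_pos hr, ← Real.exp_add, ← Real.log_le_iff_le_exp hr]
  have h1 : 0 ≤ 1 - m / n := by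
    rw [sub_nonneg, div_le_one hn]; exact hmn
  have h2 : Real.log (L / L₀) * (1 - m / n) ≤ -δ * n * (1 - m / n) := by gcongr
  have h3 : -δ * n * (1 - m / n) = -δ * (n - m) := by field_simp
  linarith

/-- Off the neighborhood, `|θ - t₀|^k` is dominated by a multiple of `|θ - t₀|⁵`, so the
fifth-moment bound applies. The ninth power of `h` pays for up to `h⁻⁵` from the scaled power and
`h⁻¹` from the Jacobian, leaving `h³`. -/
lemma LaplaceRegular.tail {Θ : Set ℝ} {lik prior : ℝ → ℝ} {t₀ : ℝ} {n : ℕ} {ε δ c M m C h : ℝ}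
    (H : LaplaceRegular Θ lik prior t₀ n ε δ c M m C) (hε : 0 < ε) (hmn : m ≤ n) (hn : 0 < n)
    (h0 : 0 < h) (h1 : h ≤ 1) (hexp : Real.exp (-δ * (n - m)) ≤ h ^ 9) (k : ℕ) (hk : k ≤ 5) :
    IntegrableOn (fun θ => ((θ - t₀) / h) ^ k * (prior θ * lik θ / (prior t₀ * lik t₀)))
      (Θ \ Set.Ioo (t₀ - ε) (t₀ + ε)) ∧
    |h⁻¹ * ∫ θ in Θ \ Set.Ioo (t₀ - ε) (t₀ + ε),
      ((θ - t₀) / h) ^ k * (prior θ * lik θ / (prior t₀ * lik t₀))| ≤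
      (1 + 1 / ε) ^ 5 * Real.exp M * C * h ^ 3 := by
  set S := Θ \ Set.Ioo (t₀ - ε) (t₀ + ε) with hSdef
  have hS : MeasurableSet S := H.measurableSet.diff measurableSet_Ioo
  have ht₀ : t₀ ∈ Set.Ioo (t₀ - ε) (t₀ + ε) := ⟨by linarith, by linarith⟩
  obtain ⟨-, hL₀, hp₀⟩ := H.nhd t₀ ht₀
  set Wt : ℝ → ℝ := fun θ => |θ - t₀| ^ 5 * prior θ * (lik θ / lik t₀) ^ (m / (n : ℝ)) with hWt
  have hWt0 : ∀ θ ∈ Θ, 0 ≤ Wt θ := fun θ hθ => by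
    have h1 := H.prior_nonneg θ hθ
    have h2 := H.lik_nonneg θ hθ
    positivity
  have hp_inv : 1 / prior t₀ ≤ Real.exp M := by
    have hb := H.prior_bound 0 (by simp) t₀ ht₀
    rw [iteratedDeriv_zero] at hb
    rw [one_div, inv_le_comm₀ hp₀ (Real.exp_pos _), ← Real.exp_neg, ← Real.le_log_iff_exp_le hp₀]
    linarith [neg_abs_le (Real.log (prior t₀))]
  set c₁ := (1 + 1 / ε) ^ 5 * Real.exp M with hc₁
  have hb : ∀ θ ∈ S, ‖((θ - t₀) / h) ^ k * (prior θ * lik θ / (prior t₀ * lik t₀))‖ ≤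
      c₁ * h ^ 4 * Wt θ := by
    rintro θ ⟨hθ, hθI⟩
    have hpn := H.prior_nonneg θ hθ
    have hln := H.lik_nonneg θ hθ
    have hdist : ε ≤ |θ - t₀| := by
      by_contra! hlt
      rw [abs_lt] at hlt
      exact hθI ⟨by linarith, by linarith⟩
    have hratio := ratio_le_of_sep hln hL₀ hmn (by exact_mod_cast hn) (H.sep θ hθ hθI)
    have hd0 : 0 ≤ |θ - t₀| := abs_nonneg _
    have hdk : |θ - t₀| ^ k ≤ (1 + 1 / ε) ^ 5 * |θ - t₀| ^ 5 := by
      have h1 : 1 ≤ (1 / ε * |θ - t₀|) ^ (5 - k) := by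
        apply one_le_pow₀
        rw [one_div, inv_mul_eq_div, one_le_div hε]
        exact hdist
      have hε1 : 1 ≤ 1 + 1 / ε := by
        have : 0 < 1 / ε := by positivity
        linarith
      calc |θ - t₀| ^ k ≤ |θ - t₀| ^ k * (1 / ε * |θ - t₀|) ^ (5 - k) :=
            le_mul_of_one_le_right (by positivity) h1
        _ = (1 / ε) ^ (5 - k) * |θ - t₀| ^ 5 := by
            rw [mul_pow, mul_left_comm, ← pow_add, Nat.add_sub_cancel' hk]
        _ ≤ (1 + 1 / ε) ^ (5 - k) * |θ - t₀| ^ 5 := by gcongr; linarith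
        _ ≤ _ := by gcongr; omega
    have hhk : (1 / h) ^ k ≤ (1 / h) ^ 5 :=
      pow_le_pow_right₀ (by rw [one_le_div h0]; exact h1) hk
    have hw : prior θ * lik θ / (prior t₀ * lik t₀) = 1 / prior t₀ * prior θ * (lik θ / lik t₀) := by
      field_simp
    have hw0 : 0 ≤ prior θ * lik θ / (prior t₀ * lik t₀) := by positivity
    rw [norm_mul, norm_pow, Real.norm_eq_abs, Real.norm_eq_abs, abs_of_nonneg hw0, hw, abs_div,
      abs_of_pos h0, div_eq_mul_one_div, mul_pow]
    have hX : 0 ≤ (lik θ / lik t₀) ^ (m / (n : ℝ)) := by positivity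
    calc |θ - t₀| ^ k * (1 / h) ^ k * (1 / prior t₀ * prior θ * (lik θ / lik t₀))
        ≤ ((1 + 1 / ε) ^ 5 * |θ - t₀| ^ 5) * (1 / h) ^ 5 * (Real.exp M * prior θ *
          (h ^ 9 * (lik θ / lik t₀) ^ (m / (n : ℝ)))) := by
          gcongr
          exact hratio.trans (by gcongr)
      _ = _ := by
          rw [hWt, hc₁]
          field_simp
  have hWi : IntegrableOn (fun θ => c₁ * h ^ 4 * Wt θ) S :=
    (H.moment_integrable.mono_set Set.sdiff_subset).const_mul _
  have hm1 := H.measurable_lik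
  have hm2 := H.measurable_prior
  refine ⟨hWi.mono' (by fun_prop) ((ae_restrict_iff' hS).2 (ae_of_all _ hb)), ?_⟩
  have hle := norm_integral_le_of_norm_le hWi ((ae_restrict_iff' hS).2 (ae_of_all _ hb))
  have hSC : ∫ θ in S, Wt θ ≤ C :=
    (setIntegral_mono_set H.moment_integrable
      ((ae_restrict_iff' H.measurableSet).2 (ae_of_all _ hWt0))
      (Set.sdiff_subset.eventuallyLE)).trans H.moment_le
  rw [integral_const_mul, Real.norm_eq_abs] at hle
  rw [abs_mul, abs_of_pos (inv_pos.2 h0), inv_mul_le_iff₀ h0]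
  have hc₁0 : 0 ≤ c₁ := by positivity
  calc _ ≤ _ := hle
    _ ≤ c₁ * h ^ 4 * C := by gcongr
    _ = _ := by ring

/-- The weight on the neighbourhood of the mode is a corrected Gaussian up to third order. -/
lemma LaplaceRegular.local_approx {Θ : Set ℝ} {lik prior : ℝ → ℝ} {t₀ : ℝ} {n : ℕ}
    {ε δ c M m C : ℝ} (H : LaplaceRegular Θ lik prior t₀ n ε δ c M m C) (hε : 0 < ε) (hc : 0 < c)
    (hn : 0 < n) (hcn : 1 ≤ c * n) :
    ∃ h A b e₂ e₄ e₆ : ℝ, 0 < h ∧ h ≤ 1 ∧ c * n * h ^ 2 ≤ 1 ∧ 1 ≤ M * n * h ^ 2 ∧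
      c ≤ M ∧ |A| ≤ M + M / c ∧ |b| ≤ M + M / c ∧
      |e₂| ≤ M + (M + M / c) ^ 2 ∧ |e₄| ≤ M + M / c + (M + M / c) ^ 2 ∧
      |e₆| ≤ (M + M / c) ^ 2 ∧
      ∀ θ ∈ Set.Ioo (t₀ - ε) (t₀ + ε),
        |prior θ * lik θ / (prior t₀ * lik t₀) - edgeworth A b e₂ e₄ e₆ h ((θ - t₀) / h)| ≤
        (1 + Real.exp (2 * M)) * ((M + M / c) + 21 * (M + M / c) ^ 2 + 125 * (M + M / c) ^ 3) *
          h ^ 3 * (1 + |(θ - t₀) / h|) ^ 15 *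
            Real.exp (-(c / (2 * M)) * ((θ - t₀) / h) ^ 2) := by
  have ht₀ : t₀ ∈ Set.Ioo (t₀ - ε) (t₀ + ε) := ⟨by linarith, by linarith⟩
  have hn' : (0 : ℝ) < n := by exact_mod_cast hn
  have hmaxl : ∀ θ ∈ Set.Ioo (t₀ - ε) (t₀ + ε), Real.log (lik θ) / n ≤ Real.log (lik t₀) / n := by
    intro θ hθ
    obtain ⟨h1, h2, -⟩ := H.nhd θ hθ
    rcases eq_or_ne θ t₀ with rfl | hne
    · rfl
    · gcongr
      exact (H.max θ h1 hne).le
  obtain ⟨a, l₃, l₄, hca, haM, h₃, h₄, hl⟩ :=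
    loglik_taylor hε hc H.smooth hmaxl H.bound H.curv
  obtain ⟨q₁, q₂, hq₁, hq₂, hq⟩ := taylor_two_bound hε H.prior_smooth H.prior_bound
  have ha : 0 < a := hc.trans_le hca
  have hM : 0 < M := ha.trans_le haM
  have hna : 1 ≤ n * a := by nlinarith
  -- The natural scale, with `n * a * h² = 1`; then `c ≤ a ≤ M` yields `c * n * h² ≤ 1 ≤ M * n *
  -- h²`.
  set h := 1 / √(n * a) with hh
  have h0 : 0 < h := by positivity
  have h1 : h ≤ 1 := by
    rw [hh, div_le_one (by positivity)]
    exact Real.one_le_sqrt.2 hna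
  have hsq : n * a * h ^ 2 = 1 := by
    rw [hh, div_pow, Real.sq_sqrt (by positivity)]
    field_simp
  have hnh : 0 ≤ n * h ^ 2 := by positivity
  have hMc : 0 < M / c := by positivity
  have hdiv : ∀ (x k : ℝ), |x| ≤ M → 1 ≤ k → |x / (k * a)| ≤ M / c := by
    intro x k hx hk
    rw [abs_div, abs_of_pos (by positivity : 0 < k * a)]
    gcongr
    nlinarith
  have hA : |l₃ / (6 * a)| ≤ M + M / c := by linarith [hdiv l₃ 6 h₃ (by norm_num)]
  have hb : |q₁| ≤ M + M / c := by linarith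
  refine ⟨h, l₃ / (6 * a), q₁, q₂ / 2 + q₁ ^ 2 / 2, l₄ / (24 * a) + q₁ * (l₃ / (6 * a)),
    (l₃ / (6 * a)) ^ 2 / 2, h0, h1, by nlinarith, by nlinarith, hca.trans haM, hA, hb, ?_, ?_,
    ?_, ?_⟩
  · refine (abs_add_le _ _).trans ?_
    rw [abs_div, abs_div, abs_two, abs_pow]
    have : |q₁| ^ 2 ≤ (M + M / c) ^ 2 := by gcongr
    linarith [abs_nonneg q₂, sq_nonneg |q₁|]
  · refine (abs_add_le _ _).trans ?_
    rw [abs_mul]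
    have : |q₁| * |l₃ / (6 * a)| ≤ (M + M / c) * (M + M / c) := by gcongr
    linarith [hdiv l₄ 24 h₄ (by norm_num)]
  · rw [abs_div, abs_two, abs_pow]
    have : |l₃ / (6 * a)| ^ 2 ≤ (M + M / c) ^ 2 := by gcongr
    linarith [sq_nonneg |l₃ / (6 * a)|]
  · intro θ hθ
    obtain ⟨hl1, hl2⟩ := hl θ hθ
    obtain ⟨-, hL, hp⟩ := H.nhd θ hθ
    obtain ⟨-, hL₀, hp₀⟩ := H.nhd t₀ ht₀
    have hpb := H.prior_bound 0 (by simp)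
    simp only [iteratedDeriv_zero] at hpb
    have hQ' : Real.log (prior θ) - Real.log (prior t₀) ≤ 2 * M := by
      linarith [le_abs_self (Real.log (prior θ)), neg_abs_le (Real.log (prior t₀)), hpb θ hθ,
        hpb t₀ ht₀]
    have := abs_local_weight_sub_edgeworth_le hc hca haM h₃ h₄ hq₁ hq₂ h0 h1 hsq hl2 hl1 (hq θ hθ)
      hQ'
    convert! this using 3
    rw [← sub_div, mul_div_cancel₀ _ hn'.ne', ← Real.log_div hL.ne' hL₀.ne',
      ← Real.log_div hp.ne' hp₀.ne', Real.exp_add, Real.exp_log (by positivity),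
      Real.exp_log (by positivity)]
    field_simp

/-! ### Moment expansion, uniform for large samples -/

lemma eventually_exp_neg_mul_le (M m : ℝ) {δ : ℝ} (hδ : 0 < δ) :
    ∀ᶠ n : ℕ in atTop, (M * n) ^ 5 * Real.exp (-δ * (n - m)) ≤ 1 := by
  have h1 : Tendsto (fun n : ℕ => δ * (n : ℝ)) atTop atTop :=
    tendsto_natCast_atTop_atTop.const_mul_atTop hδ
  have h2 := ((Real.tendsto_pow_mul_exp_neg_atTop_nhds_zero 5).comp h1).const_mul
    ((M / δ) ^ 5 * Real.exp (δ * m))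
  rw [mul_zero] at h2
  filter_upwards [h2.eventually (gt_mem_nhds one_pos)] with n hn
  refine le_trans (le_of_eq ?_) hn.le
  have e : -δ * (n - m) = δ * m + -(δ * n) := by ring
  rw [e, Real.exp_add]
  simp only [Function.comp_apply]
  field_simp

/-- The constant and the threshold for `n` are chosen before the model and the mode. This order is
essential, because the maximizer and the likelihood vary with `n`. -/
lemma exists_moment_approx {ε δ c : ℝ} (M m C : ℝ) (hε : 0 < ε) (hδ : 0 < δ) (hc : 0 < c) :
    ∃ K : ℝ, ∀ᶠ n : ℕ in atTop, ∀ (Θ : Set ℝ) (lik prior : ℝ → ℝ) (t₀ : ℝ),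
      LaplaceRegular Θ lik prior t₀ n ε δ c M m C →
      ∃ h A b e₂ e₄ e₆ : ℝ, 0 < h ∧ h ≤ 1 ∧ c * n * h ^ 2 ≤ 1 ∧
        |A| ≤ K ∧ |b| ≤ K ∧ |e₂| ≤ K ∧ |e₄| ≤ K ∧ |e₆| ≤ K ∧ ∀ k ≤ 5,
        IntegrableOn (fun θ => ((θ - t₀) / h) ^ k * (prior θ * lik θ / (prior t₀ * lik t₀))) Θ ∧
        |h⁻¹ * (∫ θ in Θ, ((θ - t₀) / h) ^ k * (prior θ * lik θ / (prior t₀ * lik t₀))) -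
          ∫ y, y ^ k * edgeworth A b e₂ e₄ e₆ h y| ≤ K * h ^ 3 := by
  set K₂ := M + M / c with hK₂
  set K₃ := M + K₂ + K₂ ^ 2 with hK₃
  set K₄ := (1 + Real.exp (2 * M)) * (K₂ + 21 * K₂ ^ 2 + 125 * K₂ ^ 3) + (1 + 5 * K₃) / ε ^ 3
    with hK₄
  set K₅ := K₄ * (∫ y, (1 + |y|) ^ 20 * Real.exp (-(c / (2 * M)) * y ^ 2)) +
    (1 + 1 / ε) ^ 5 * Real.exp M * C with hK₅
  -- The absolute value is needed because no sign of `C` is assumed.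
  refine ⟨K₃ + |K₅|, ?_⟩
  filter_upwards [eventually_exp_neg_mul_le M m hδ, eventually_gt_atTop 0,
    tendsto_natCast_atTop_atTop.eventually (eventually_ge_atTop (1 / c)),
    tendsto_natCast_atTop_atTop.eventually (eventually_ge_atTop m)] with n hexp hn hnc hnm
  intro Θ lik prior t₀ H
  have hcn : 1 ≤ c * n := by
    rw [div_le_iff₀ hc] at hnc
    linarith
  obtain ⟨h, A, b, e₂, e₄, e₆, h0, h1, hch, hMh, hcM, hA, hb, h₂, h₄, h₆, happ⟩ :=
    H.local_approx hε hc hn hcn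
  have hM : 0 < M := hc.trans_le hcM
  have hMc : 0 < M / c := by positivity
  have hK₂0 : 0 < K₂ := by positivity
  have hK₂sq : 0 < K₂ ^ 2 := by positivity
  have hK₃0 : 0 < K₃ := by positivity
  have hK5 := abs_nonneg K₅
  -- The lower bound `1 ≤ M * n * h²` trades the polynomial decay in `n` for `h¹⁰`.
  have hexp9 : Real.exp (-δ * (n - m)) ≤ h ^ 9 := by
    calc Real.exp (-δ * (n - m)) ≤ (M * n * h ^ 2) ^ 5 * Real.exp (-δ * (n - m)) :=
          le_mul_of_one_le_left (Real.exp_pos _).le (one_le_pow₀ hMh)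
      _ = ((M * n) ^ 5 * Real.exp (-δ * (n - m))) * h ^ 10 := by ring
      _ ≤ 1 * h ^ 10 := by gcongr
      _ ≤ h ^ 9 := by rw [one_mul]; exact pow_le_pow_of_le_one h0.le h1 (by norm_num)
  set N := Set.Ioo (t₀ - ε) (t₀ + ε) with hN
  have hNΘ : N ⊆ Θ := fun θ hθ => (H.nhd θ hθ).1
  set w : ℝ → ℝ := fun θ => prior θ * lik θ / (prior t₀ * lik t₀) with hw
  have hwm : Measurable w := by
    have hm1 := H.measurable_lik
    have hm2 := H.measurable_prior
    fun_prop
  have hρ : 0 < c / (2 * M) := by positivity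
  -- On `N` this is the local approximation; off `N` the indicator vanishes and the corrected
  -- Gaussian is itself `O(h³)`.
  have happ' : ∀ θ, |N.indicator w θ - edgeworth A b e₂ e₄ e₆ h ((θ - t₀) / h)| ≤
      (K₄ * h ^ 3) * (1 + |(θ - t₀) / h|) ^ 15 *
        Real.exp (-(c / (2 * M)) * ((θ - t₀) / h) ^ 2) := by
    intro θ
    by_cases hθ : θ ∈ N
    · rw [Set.indicator_of_mem hθ]
      refine (happ θ hθ).trans ?_
      gcongr
      rw [hK₄]
      exact le_add_of_nonneg_right (by positivity)
    · rw [Set.indicator_of_notMem hθ, zero_sub, abs_neg]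
      have hρ2 : c / (2 * M) ≤ 1 / 2 := by
        rw [div_le_div_iff₀ (by positivity) (by norm_num)]
        linarith
      have hs : ε ≤ h * |(θ - t₀) / h| := by
        rw [abs_div, abs_of_pos h0, mul_div_cancel₀ _ h0.ne']
        by_contra! hlt
        rw [abs_lt] at hlt
        exact hθ ⟨by linarith, by linarith⟩
      refine (abs_edgeworth_le_of_le (K := K₃) (by linarith) (by linarith) (by linarith)
        (by linarith) (by linarith) h0 h1 hε hρ2 hs).trans ?_
      gcongr
      rw [hK₄]
      exact le_add_of_nonneg_left (by positivity)
  refine ⟨h, A, b, e₂, e₄, e₆, h0, h1, hch, by linarith, by linarith, by linarith, by linarith,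
    by linarith, fun k hk => ?_⟩
  obtain ⟨hi1, hl1⟩ := scaled_moment_of_approx measurableSet_Ioo hwm h0 hρ
    (integrable_pow_mul_edgeworth A b e₂ e₄ e₆ h) happ' k hk
  obtain ⟨hi2, hl2⟩ := H.tail hε hnm hn h0 h1 hexp9 k hk
  have hunion : N ∪ (Θ \ N) = Θ := Set.union_sdiff_cancel hNΘ
  have hint : IntegrableOn (fun θ => ((θ - t₀) / h) ^ k * w θ) Θ := by
    rw [← hunion]
    exact hi1.union hi2
  refine ⟨hint, ?_⟩
  have hsplit : ∫ θ in Θ, ((θ - t₀) / h) ^ k * w θ =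
      (∫ θ in N, ((θ - t₀) / h) ^ k * w θ) + ∫ θ in Θ \ N, ((θ - t₀) / h) ^ k * w θ := by
    rw [← setIntegral_union Set.disjoint_sdiff_right (H.measurableSet.diff measurableSet_Ioo) hi1
      hi2, hunion]
  rw [hsplit]
  have e : h⁻¹ * ((∫ θ in N, ((θ - t₀) / h) ^ k * w θ) + ∫ θ in Θ \ N, ((θ - t₀) / h) ^ k * w θ) -
      ∫ y, y ^ k * edgeworth A b e₂ e₄ e₆ h y =
      (h⁻¹ * (∫ θ in N, ((θ - t₀) / h) ^ k * w θ) - ∫ y, y ^ k * edgeworth A b e₂ e₄ e₆ h y) +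
      h⁻¹ * ∫ θ in Θ \ N, ((θ - t₀) / h) ^ k * w θ := by ring
  rw [e]
  refine (abs_add_le _ _).trans ((add_le_add hl1 hl2).trans ?_)
  have h3 : 0 < h ^ 3 := by positivity
  calc _ = K₅ * h ^ 3 := by rw [hK₅]; ring
    _ ≤ (K₃ + |K₅|) * h ^ 3 := by
      gcongr
      linarith [le_abs_self K₅]

/-- The weighted moments about the mode, in units of `h`, are those of a standard Gaussian up to
corrections of first order (odd moments) and second order (even moments). -/
lemma exists_moment_expansion {ε δ c : ℝ} (M m C : ℝ) (hε : 0 < ε) (hδ : 0 < δ) (hc : 0 < c) :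
    ∃ K : ℝ, ∀ᶠ n : ℕ in atTop, ∀ (Θ : Set ℝ) (lik prior : ℝ → ℝ) (t₀ : ℝ),
      LaplaceRegular Θ lik prior t₀ n ε δ c M m C →
      ∃ (h A b g : ℝ) (r I : ℕ → ℝ), 0 < h ∧ h ≤ 1 ∧ c * n * h ^ 2 ≤ 1 ∧ 0 < g ∧
        |A| ≤ K ∧ |b| ≤ K ∧ (∀ k ≤ 5, |r k| ≤ K) ∧ (∀ k ≤ 5,
        IntegrableOn (fun θ => ((θ - t₀) / h) ^ k * (prior θ * lik θ / (prior t₀ * lik t₀))) Θ ∧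
        ∫ θ in Θ, ((θ - t₀) / h) ^ k * (prior θ * lik θ / (prior t₀ * lik t₀)) = g * I k) ∧
        I 0 = 1 + h ^ 2 * r 0 ∧ I 1 = h * (b + 3 * A) + h ^ 3 * r 1 ∧ I 2 = 1 + h ^ 2 * r 2 ∧
        I 3 = h * (3 * b + 15 * A) + h ^ 3 * r 3 ∧ I 4 = 3 + h ^ 2 * r 4 ∧
        I 5 = h * (15 * b + 105 * A) + h ^ 3 * r 5 := by
  obtain ⟨K, hK⟩ := exists_moment_approx M m C hε hδ hc
  have hγ := gaussMoment_zero_pos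
  set γ := gaussMoment 0 with hγdef
  have g2 : gaussMoment 2 = γ := by rw [gaussMoment_add_two]; simp [hγdef]
  have g4 : gaussMoment 4 = 3 * γ := by
    rw [gaussMoment_add_two 2, g2]; norm_num
  have g6 : gaussMoment 6 = 15 * γ := by
    rw [gaussMoment_add_two 4, g4]; push_cast; ring
  have g8 : gaussMoment 8 = 105 * γ := by
    rw [gaussMoment_add_two 6, g6]; push_cast; ring
  have g10 : gaussMoment 10 = 945 * γ := by
    rw [gaussMoment_add_two 8, g8]; push_cast; ring
  have hex := fun A b e₂ e₄ e₆ h k => integral_pow_mul_edgeworth A b e₂ e₄ e₆ h k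
  -- `1065 = 15 + 105 + 945` bounds the Gaussian factors of `e₂, e₄, e₆` in the even moments of
  -- order at most four.
  refine ⟨K / γ + 1065 * K, hK.mono fun n hn Θ lik prior t₀ H => ?_⟩
  obtain ⟨h, A, b, e₂, e₄, e₆, h0, h1, hch, hA, hb, h₂, h₄, h₆, hI⟩ := hn Θ lik prior t₀ H
  have hK0 : 0 ≤ K := (abs_nonneg _).trans hA
  have hKγ : 0 ≤ K / γ := by positivity
  set J : ℕ → ℝ := fun k =>
    ∫ θ in Θ, ((θ - t₀) / h) ^ k * (prior θ * lik θ / (prior t₀ * lik t₀)) with hJ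
  set d : ℕ → ℝ := fun k => (h⁻¹ * J k - ∫ y, y ^ k * edgeworth A b e₂ e₄ e₆ h y) / (γ * h ^ 3)
    with hd
  have hdK : ∀ k ≤ 5, |d k| ≤ K / γ := by
    intro k hk
    rw [hd, abs_div, abs_of_pos (by positivity : 0 < γ * h ^ 3), div_le_div_iff₀ (by positivity) hγ]
    have := (hI k hk).2
    calc _ ≤ K * h ^ 3 * γ := by gcongr
      _ = _ := by ring
  have hJd : ∀ k, h⁻¹ * J k = (∫ y, y ^ k * edgeworth A b e₂ e₄ e₆ h y) + γ * h ^ 3 * d k := by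
    intro k
    rw [hd]
    field_simp
    ring
  set E : ℕ → ℝ := fun k => (e₂ * gaussMoment (k + 2) + e₄ * gaussMoment (k + 4) +
    e₆ * gaussMoment (k + 6)) / γ with hE
  -- The common factor is the Jacobian times the Gaussian mass. For even `k` the remainder collects
  -- the `h²` term and the error; for odd `k` the `h²` term vanishes by parity.
  refine ⟨h, A, b, h * γ, fun k => if Even k then E k + h * d k else d k,
    fun k => J k / (h * γ), h0, h1, hch, by positivity, by linarith, by linarith, ?_, ?_, ?_⟩
  · have hEb : ∀ x y z : ℝ, 0 ≤ x → 0 ≤ y → 0 ≤ z →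
        x + y + z ≤ 1065 → |(e₂ * (x * γ) + e₄ * (y * γ) + e₆ * (z * γ)) / γ| ≤ 1065 * K := by
      intro x y z hx hy hz hxyz
      have e : (e₂ * (x * γ) + e₄ * (y * γ) + e₆ * (z * γ)) / γ = e₂ * x + e₄ * y + e₆ * z := by
        field_simp
      rw [e]
      refine (abs_add_three _ _ _).trans ?_
      rw [abs_mul, abs_mul, abs_mul, abs_of_nonneg hx, abs_of_nonneg hy, abs_of_nonneg hz]
      nlinarith
    have hev : ∀ k ≤ 5, |E k| ≤ 1065 * K → |E k + h * d k| ≤ K / γ + 1065 * K := by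
      intro k hk hEk
      refine (abs_add_le _ _).trans ?_
      rw [abs_mul, abs_of_pos h0]
      have := mul_le_of_le_one_left (abs_nonneg (d k)) h1
      linarith [hdK k hk]
    have hodd : ∀ k ≤ 5, |d k| ≤ K / γ + 1065 * K := fun k hk => by linarith [hdK k hk]
    intro k hk
    simp only
    split_ifs with hk2
    · apply hev k hk
      interval_cases k
      · simpa [hE, g2, g4, g6] using hEb 1 3 15 (by norm_num) (by norm_num) (by norm_num)
          (by norm_num)
      · simp at hk2
      · simpa [hE, g4, g6, g8] using hEb 3 15 105 (by norm_num) (by norm_num) (by norm_num)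
          (by norm_num)
      · exact absurd hk2 (by decide)
      · simpa [hE, g6, g8, g10] using hEb 15 105 945 (by norm_num) (by norm_num) (by norm_num)
          (by norm_num)
      · exact absurd hk2 (by decide)
    · exact hodd k hk
  · intro k hk
    refine ⟨(hI k hk).1, ?_⟩
    change J k = _
    field_simp
  · have hJ' : ∀ k, J k / (h * γ) = (h⁻¹ * J k) / γ := by intro k; field_simp
    have i1 : ¬ Even 1 := by decide
    have i2 : Even 2 := by decide
    have i3 : ¬ Even 3 := by decide
    have i4 : Even 4 := by decide
    have i5 : ¬ Even 5 := by decide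
    have o1 := gaussMoment_odd 1 (by decide)
    have o3 := gaussMoment_odd 3 (by decide)
    have o5 := gaussMoment_odd 5 (by decide)
    have o7 := gaussMoment_odd 7 (by decide)
    have o9 := gaussMoment_odd 9 (by decide)
    have o11 := gaussMoment_odd 11 (by decide)
    simp only [hJ', hJd, hex, hE, Even.zero, i1, i2, i3, i4, i5, if_true, if_false, zero_add,
      Nat.reduceAdd, o1, o3, o5, o7, o9, o11, g2, g4, g6, g8, g10, ← hγdef]
    refine ⟨?_, ?_, ?_, ?_, ?_, ?_⟩ <;> field_simp <;> ring

/-! ### Cumulants of a standardized variable from raw moments -/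

section Cumulants

variable {Ω : Type*} [MeasurableSpace Ω] {μ : Measure Ω} {X : Ω → ℝ}

lemma cumulant_succ (X : Ω → ℝ) (μ : Measure Ω) (n : ℕ) :
    cumulant X μ (n + 1) = moment X (n + 1) μ -
      ∑ k ∈ Finset.range n, (n.choose k : ℝ) * cumulant X μ (k + 1) * moment X (n - k) μ := by
  rw [cumulant, Finset.sum_range]

lemma cumulants_of_centered (h1 : moment X 1 μ = 0) :
    cumulant X μ 3 = moment X 3 μ ∧
    cumulant X μ 4 = moment X 4 μ - 3 * moment X 2 μ ^ 2 ∧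
    cumulant X μ 5 = moment X 5 μ - 10 * moment X 3 μ * moment X 2 μ := by
  have c1 := cumulant_succ X μ 0
  have c2 := cumulant_succ X μ 1
  have c3 := cumulant_succ X μ 2
  have c4 := cumulant_succ X μ 3
  have c5 := cumulant_succ X μ 4
  norm_num [Finset.sum_range_succ, h1, Nat.choose] at c1 c2 c3 c4 c5
  simp only [c1] at c2 c3 c4 c5
  simp only [c2] at c3 c4 c5
  simp only [c3] at c4 c5
  refine ⟨?_, ?_, ?_⟩
  · rw [c3]; ring
  · rw [c4]; ring
  · rw [c5]; ring

lemma moment_sub_div (hX : ∀ k ≤ 5, Integrable (fun ω => X ω ^ k) μ) (a d : ℝ) (k : ℕ)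
    (hk : k ≤ 5) :
    moment (fun ω => (X ω - a) / d) k μ =
      (∑ i ∈ Finset.range (k + 1), (-a) ^ (k - i) * (k.choose i : ℝ) * ∫ ω, X ω ^ i ∂μ) / d ^ k := by
  have e : ((fun ω => (X ω - a) / d) ^ k : Ω → ℝ) = fun ω =>
      (∑ i ∈ Finset.range (k + 1), (-a) ^ (k - i) * (k.choose i : ℝ) * X ω ^ i) / d ^ k := by
    ext ω
    rw [Pi.pow_apply, div_pow, sub_eq_add_neg, add_pow]
    congr 1
    exact Finset.sum_congr rfl fun i _ => by ring
  rw [moment_def, e, integral_div, integral_finsetSum]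
  · simp_rw [integral_const_mul]
  · intro i hi
    exact (hX i (by have := Finset.mem_range.1 hi; omega)).const_mul _

/-- Cumulants of the standardization of `X` in terms of the moments of `X`. -/
lemma cumulant_standardize [IsProbabilityMeasure μ]
    (hX : ∀ k ≤ 5, Integrable (fun ω => X ω ^ k) μ) {m : ℕ → ℝ} {d : ℝ}
    (hm : ∀ k ≤ 5, ∫ ω, X ω ^ k ∂μ = m k) (hd : d ≠ 0) :
    cumulant (fun ω => (X ω - m 1) / d) μ 3 = (m 3 - 3 * m 2 * m 1 + 2 * m 1 ^ 3) / d ^ 3 ∧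
    cumulant (fun ω => (X ω - m 1) / d) μ 4 =
      (m 4 - 4 * m 3 * m 1 - 3 * m 2 ^ 2 + 12 * m 2 * m 1 ^ 2 - 6 * m 1 ^ 4) / d ^ 4 ∧
    cumulant (fun ω => (X ω - m 1) / d) μ 5 =
      (m 5 - 5 * m 4 * m 1 - 10 * m 3 * m 2 + 20 * m 3 * m 1 ^ 2 + 30 * m 2 ^ 2 * m 1 -
        60 * m 2 * m 1 ^ 3 + 24 * m 1 ^ 5) / d ^ 5 := by
  have hm0 : m 0 = 1 := by rw [← hm 0 (by norm_num)]; simp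
  have M := moment_sub_div hX (m 1) d
  have M0 := M 0 (by norm_num)
  have M1 := M 1 (by norm_num)
  have M2 := M 2 (by norm_num)
  have M3 := M 3 (by norm_num)
  have M4 := M 4 (by norm_num)
  have M5 := M 5 (by norm_num)
  simp only [Finset.sum_range_succ, Finset.sum_range_zero, hm 0 (by norm_num), hm 1 (by norm_num),
    hm 2 (by norm_num), hm 3 (by norm_num), hm 4 (by norm_num), hm 5 le_rfl, hm0]
    at M0 M1 M2 M3 M4 M5
  norm_num [Nat.choose] at M0 M1 M2 M3 M4 M5
  -- By now `M1` says that the centered variable has first moment zero.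
  obtain ⟨c3, c4, c5⟩ := cumulants_of_centered M1
  rw [c3, c4, c5, M2, M3, M4, M5]
  refine ⟨?_, ?_, ?_⟩ <;> field_simp <;> ring

end Cumulants

/-! ### Cumulants under perturbed Gaussian moments -/

/-- Once the right power of `h` is factored out, each cumulant numerator is a polynomial in bounded
quantities; compactness of the box replaces explicit constants. -/
lemma exists_bound_of_continuous {n : ℕ} {p : (Fin n → ℝ) → ℝ} (hp : Continuous p) (K : ℝ) :
    ∃ B : ℝ, 0 ≤ B ∧ ∀ v : Fin n → ℝ, (∀ i, |v i| ≤ K) → |p v| ≤ B := by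
  obtain ⟨B, hB⟩ := (isCompact_univ_pi fun _ : Fin n => isCompact_Icc (a := -K) (b := K))
    |>.exists_bound_of_continuousOn hp.continuousOn
  exact ⟨|B|, abs_nonneg B, fun v hv => (hB v fun i _ => abs_le.1 (hv i)).trans (le_abs_self B)⟩

/-- The cumulants of a distribution whose moments are perturbed Gaussian moments. -/
lemma exists_cumulant_numerator_bound (K : ℝ) : ∃ B : ℝ, 0 ≤ B ∧
    ∀ (h A b : ℝ) (r m : ℕ → ℝ), 0 < h → h ≤ 1 → |A| ≤ K → |b| ≤ K → (∀ k ≤ 5, |r k| ≤ K) →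
      m 1 = h * (b + 3 * A) + h ^ 3 * r 1 → m 2 = 1 + h ^ 2 * r 2 →
      m 3 = h * (3 * b + 15 * A) + h ^ 3 * r 3 → m 4 = 3 + h ^ 2 * r 4 →
      m 5 = h * (15 * b + 105 * A) + h ^ 3 * r 5 →
      |m 2 - m 1 ^ 2 - 1| ≤ B * h ^ 2 ∧
      |m 3 - 3 * m 2 * m 1 + 2 * m 1 ^ 3| ≤ B * h ∧
      |m 4 - 4 * m 3 * m 1 - 3 * m 2 ^ 2 + 12 * m 2 * m 1 ^ 2 - 6 * m 1 ^ 4| ≤ B * h ^ 2 ∧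
      |m 5 - 5 * m 4 * m 1 - 10 * m 3 * m 2 + 20 * m 3 * m 1 ^ 2 + 30 * m 2 ^ 2 * m 1 -
        60 * m 2 * m 1 ^ 3 + 24 * m 1 ^ 5| ≤ B * h ^ 3 := by
  -- the coordinates are `h`, `m 1 / h`, `m 3 / h`, `r 2`, `r 4`, `r 5 + 15 * r 1 - 10 * r 3`
  obtain ⟨B₂, h₂, hB₂⟩ := exists_bound_of_continuous (n := 6)
    (p := fun v => v 3 - v 1 ^ 2) (by fun_prop) (1 + 26 * K)
  obtain ⟨B₃, h₃, hB₃⟩ := exists_bound_of_continuous (n := 6)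
    (p := fun v => v 2 - 3 * (1 + v 0 ^ 2 * v 3) * v 1 + 2 * v 0 ^ 2 * v 1 ^ 3) (by fun_prop)
    (1 + 26 * K)
  -- The constant terms `3 - 3 * 1²` cancel.
  obtain ⟨B₄, h₄, hB₄⟩ := exists_bound_of_continuous (n := 6)
    (p := fun v => v 4 - 4 * v 2 * v 1 - 6 * v 3 - 3 * v 0 ^ 2 * v 3 ^ 2 +
      12 * (1 + v 0 ^ 2 * v 3) * v 1 ^ 2 - 6 * v 0 ^ 2 * v 1 ^ 4) (by fun_prop) (1 + 26 * K)
  -- At order `h` everything cancels: `15 - 15 - 30 + 30 = 0` for `b` and `105 - 45 - 150 + 90 = 0`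
  -- for `A`.
  obtain ⟨B₅, h₅, hB₅⟩ := exists_bound_of_continuous (n := 6)
    (p := fun v => v 5 - 5 * v 4 * v 1 - 10 * v 3 * v 2 + 20 * v 2 * v 1 ^ 2 +
      30 * (2 * v 3 + v 0 ^ 2 * v 3 ^ 2) * v 1 - 60 * (1 + v 0 ^ 2 * v 3) * v 1 ^ 3 +
      24 * v 0 ^ 2 * v 1 ^ 5) (by fun_prop) (1 + 26 * K)
  refine ⟨B₂ + B₃ + B₄ + B₅, by positivity, ?_⟩
  intro h A b r m h0 h1 hA hb hr m1 m2 m3 m4 m5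
  have hK : 0 ≤ K := (abs_nonneg _).trans hA
  have hh2 : h ^ 2 ≤ 1 := pow_le_one₀ h0.le h1
  have hhr : ∀ k ≤ 5, |h ^ 2 * r k| ≤ K := fun k hk => by
    rw [abs_mul, abs_of_pos (by positivity)]
    exact (mul_le_of_le_one_left (abs_nonneg _) hh2).trans (hr k hk)
  set v : Fin 6 → ℝ := ![h, b + 3 * A + h ^ 2 * r 1, 3 * b + 15 * A + h ^ 2 * r 3, r 2, r 4,
    r 5 + 15 * r 1 - 10 * r 3] with hv
  have hvK : ∀ i, |v i| ≤ 1 + 26 * K := by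
    have a1 := abs_le.1 hA
    have a2 := abs_le.1 hb
    have a3 := abs_le.1 (hhr 1 (by norm_num))
    have a4 := abs_le.1 (hhr 3 (by norm_num))
    have b1 := abs_le.1 (hr 1 (by norm_num))
    have b2 := abs_le.1 (hr 2 (by norm_num))
    have b3 := abs_le.1 (hr 3 (by norm_num))
    have b4 := abs_le.1 (hr 4 (by norm_num))
    have b5 := abs_le.1 (hr 5 (by norm_num))
    intro i
    rw [abs_le]
    fin_cases i <;> simp [hv] <;> constructor <;> linarith
  have v0 : v 0 = h := rfl
  have v1 : v 1 = b + 3 * A + h ^ 2 * r 1 := rfl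
  have v2 : v 2 = 3 * b + 15 * A + h ^ 2 * r 3 := rfl
  have v3 : v 3 = r 2 := rfl
  have v4 : v 4 = r 4 := rfl
  have v5 : v 5 = r 5 + 15 * r 1 - 10 * r 3 := rfl
  have fin : ∀ (x y B : ℝ) (j : ℕ), |y| ≤ B → B ≤ B₂ + B₃ + B₄ + B₅ → x = h ^ j * y →
      |x| ≤ (B₂ + B₃ + B₄ + B₅) * h ^ j := by
    intro x y B j hy hB hx
    rw [hx, abs_mul, abs_of_pos (by positivity), mul_comm]
    gcongr
    exact hy.trans hB
  refine ⟨fin _ _ _ 2 (hB₂ v hvK) (by linarith) ?_, ?_, fin _ _ _ 2 (hB₄ v hvK) (by linarith) ?_,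
    fin _ _ _ 3 (hB₅ v hvK) (by linarith) ?_⟩
  · simp only [v1, v3, m1, m2]; ring
  · have := fin (m 3 - 3 * m 2 * m 1 + 2 * m 1 ^ 3) _ _ 1 (hB₃ v hvK) (by linarith)
      (by simp only [v0, v1, v2, v3, m1, m2, m3]; ring)
    rwa [pow_one] at this
  · simp only [v0, v1, v2, v3, v4, m1, m2, m3, m4]; ring
  · simp only [v0, v1, v2, v3, v4, v5, m1, m2, m3, m4, m5]; ring

/-- Normalizing the expansion of the moments by the moment of order zero. -/
lemma exists_normalized_expansion {h A b K : ℝ} {r I : ℕ → ℝ}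
    (hA : |A| ≤ K) (hb : |b| ≤ K) (hr : ∀ k ≤ 5, |r k| ≤ K) (hK : K * h ^ 2 ≤ 1 / 2)
    (I0 : I 0 = 1 + h ^ 2 * r 0) (I1 : I 1 = h * (b + 3 * A) + h ^ 3 * r 1)
    (I2 : I 2 = 1 + h ^ 2 * r 2) (I3 : I 3 = h * (3 * b + 15 * A) + h ^ 3 * r 3)
    (I4 : I 4 = 3 + h ^ 2 * r 4) (I5 : I 5 = h * (15 * b + 105 * A) + h ^ 3 * r 5) :
    0 < I 0 ∧ ∃ R : ℕ → ℝ, (∀ k ≤ 5, |R k| ≤ 8 * K + 240 * K ^ 2) ∧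
      I 1 / I 0 = h * (b + 3 * A) + h ^ 3 * R 1 ∧ I 2 / I 0 = 1 + h ^ 2 * R 2 ∧
      I 3 / I 0 = h * (3 * b + 15 * A) + h ^ 3 * R 3 ∧ I 4 / I 0 = 3 + h ^ 2 * R 4 ∧
      I 5 / I 0 = h * (15 * b + 105 * A) + h ^ 3 * R 5 := by
  have hK0 : 0 ≤ K := (abs_nonneg _).trans hA
  have hr0 := hr 0 (by norm_num)
  have hlow : 1 / 2 ≤ I 0 := by
    have := neg_abs_le (r 0)
    rw [I0]
    nlinarith [sq_nonneg h]
  have hpos : 0 < I 0 := by linarith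
  set q : ℕ → ℝ := ![1, b + 3 * A, 1, 3 * b + 15 * A, 3, 15 * b + 105 * A, 0] ∘ Fin.ofNat 7 with hq
  have hqb : ∀ k ≤ 5, |q k| ≤ 3 + 120 * K := by
    have a1 := abs_le.1 hA
    have a2 := abs_le.1 hb
    intro k hk
    rw [abs_le]
    interval_cases k <;> simp [hq, Fin.ofNat] <;> constructor <;> linarith
  have q1 : q 1 = b + 3 * A := rfl
  have q2 : q 2 = 1 := rfl
  have q3 : q 3 = 3 * b + 15 * A := rfl
  have q4 : q 4 = 3 := rfl
  have q5 : q 5 = 15 * b + 105 * A := rfl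
  -- With `q k` the leading coefficient, dividing by `I 0 = 1 + h² r 0` changes it only two orders
  -- of `h` later.
  refine ⟨hpos, fun k => (r k - q k * r 0) / I 0, ?_, ?_, ?_, ?_, ?_, ?_⟩
  · intro k hk
    simp only
    rw [abs_div, abs_of_pos hpos, div_le_iff₀ hpos]
    have e1 : |q k * r 0| ≤ (3 + 120 * K) * K := by
      rw [abs_mul]
      gcongr
      exact hqb k hk
    have e2 : |r k - q k * r 0| ≤ K + (3 + 120 * K) * K :=
      (abs_sub _ _).trans (add_le_add (hr k hk) e1)
    have e3 : (8 * K + 240 * K ^ 2) * (1 / 2) ≤ (8 * K + 240 * K ^ 2) * I 0 := by gcongr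
    nlinarith
  all_goals
    simp only [q1, q2, q3, q4, q5]
    rw [div_eq_iff hpos.ne']
    simp only [I1, I2, I3, I4, I5]
    field_simp
    rw [I0]
    ring

/-! ### Posterior integrals and affine invariance -/

section Posterior

variable {𝓧 : Type*} {Θ : Set ℝ} {f : 𝓧 → ℝ → ℝ} {prior : ℝ → ℝ} {x : ℕ → 𝓧} {n : ℕ}

/-- Integrals against the posterior, in terms of a weight proportional to its density. -/
lemma posterior_integral (hΘ : MeasurableSet Θ) (hp : Measurable prior)
    (hL : Measurable (likelihood f x n)) (hp0 : ∀ θ ∈ Θ, 0 ≤ prior θ)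
    (hL0 : ∀ θ ∈ Θ, 0 ≤ likelihood f x n θ) {d : ℝ} (hd : 0 < d)
    (hZ : 0 < ∫ θ in Θ, prior θ * likelihood f x n θ / d) (F : ℝ → ℝ)
    (hF : IntegrableOn (fun θ => F θ * (prior θ * likelihood f x n θ / d)) Θ) :
    Integrable F (posteriorMeasure Θ f prior x n) ∧
    ∫ θ, F θ ∂(posteriorMeasure Θ f prior x n) =
      (∫ θ in Θ, F θ * (prior θ * likelihood f x n θ / d)) /
        ∫ θ in Θ, prior θ * likelihood f x n θ / d := by
  set Z := ∫ θ in Θ, prior θ * likelihood f x n θ with hZdef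
  have hZd : ∫ θ in Θ, prior θ * likelihood f x n θ / d = Z / d := integral_div _ _
  rw [hZd] at hZ ⊢
  have hZ0 : 0 < Z := by
    have := mul_pos hZ hd
    rwa [div_mul_cancel₀ _ hd.ne'] at this
  have hm : Measurable (fun θ => (posteriorDensity Θ f prior x n θ).toNNReal) := by
    unfold posteriorDensity
    fun_prop
  have hae : (fun θ => (posteriorDensity Θ f prior x n θ).toNNReal • F θ) =ᵐ[volume.restrict Θ]
      fun θ => d / Z * (F θ * (prior θ * likelihood f x n θ / d)) := by
    refine (ae_restrict_iff' hΘ).2 (ae_of_all _ fun θ hθ => ?_)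
    have h1 := hp0 θ hθ
    have h2 := hL0 θ hθ
    have h3 : 0 ≤ posteriorDensity Θ f prior x n θ := by
      unfold posteriorDensity
      rw [← hZdef]
      positivity
    simp only [NNReal.smul_def, Real.coe_toNNReal _ h3, smul_eq_mul]
    unfold posteriorDensity
    rw [← hZdef]
    field_simp
  have hμ : posteriorMeasure Θ f prior x n = (volume.restrict Θ).withDensity
      (fun θ => ((posteriorDensity Θ f prior x n θ).toNNReal : ENNReal)) := rfl
  rw [hμ]
  constructor
  · rw [integrable_withDensity_iff_integrable_smul hm]
    exact (hF.const_mul (d / Z)).congr hae.symm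
  · rw [integral_withDensity_eq_integral_smul hm, integral_congr_ae hae, integral_const_mul]
    field_simp

lemma posterior_isProbabilityMeasure (hΘ : MeasurableSet Θ) (hp : Measurable prior)
    (hL : Measurable (likelihood f x n)) (hp0 : ∀ θ ∈ Θ, 0 ≤ prior θ)
    (hL0 : ∀ θ ∈ Θ, 0 ≤ likelihood f x n θ) {d : ℝ} (hd : 0 < d)
    (hZ : 0 < ∫ θ in Θ, prior θ * likelihood f x n θ / d)
    (hi : IntegrableOn (fun θ => prior θ * likelihood f x n θ / d) Θ) :
    IsProbabilityMeasure (posteriorMeasure Θ f prior x n) := by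
  obtain ⟨h1, h2⟩ := posterior_integral hΘ hp hL hp0 hL0 hd hZ (fun _ => 1) (by simpa using hi)
  have hfin : IsFiniteMeasure (posteriorMeasure Θ f prior x n) :=
    (integrable_const_iff_isFiniteMeasure one_ne_zero).1 h1
  simp only [one_mul, div_self hZ.ne', integral_const, smul_eq_mul, mul_one] at h2
  constructor
  rw [← ENNReal.toReal_eq_one_iff]
  exact h2

/-- The invariant cumulants from the moments of the rescaled parameter `(θ - t₀) / h`. -/
lemma posterior_cumulants [IsProbabilityMeasure (posteriorMeasure Θ f prior x n)] {t₀ h : ℝ}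
    {m : ℕ → ℝ} (h0 : 0 < h)
    (hX : ∀ k ≤ 5, Integrable (fun θ => ((θ - t₀) / h) ^ k) (posteriorMeasure Θ f prior x n))
    (hm : ∀ k ≤ 5, ∫ θ, ((θ - t₀) / h) ^ k ∂(posteriorMeasure Θ f prior x n) = m k)
    (hV : 0 < m 2 - m 1 ^ 2) :
    MemLp (fun θ : ℝ => θ) 5 (posteriorMeasure Θ f prior x n) ∧
    0 < posteriorSD Θ f prior x n ∧
    invariantCumulant Θ f prior x n 3 =
      (m 3 - 3 * m 2 * m 1 + 2 * m 1 ^ 3) / √(m 2 - m 1 ^ 2) ^ 3 ∧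
    invariantCumulant Θ f prior x n 4 =
      (m 4 - 4 * m 3 * m 1 - 3 * m 2 ^ 2 + 12 * m 2 * m 1 ^ 2 - 6 * m 1 ^ 4) /
        √(m 2 - m 1 ^ 2) ^ 4 ∧
    invariantCumulant Θ f prior x n 5 =
      (m 5 - 5 * m 4 * m 1 - 10 * m 3 * m 2 + 20 * m 3 * m 1 ^ 2 + 30 * m 2 ^ 2 * m 1 -
        60 * m 2 * m 1 ^ 3 + 24 * m 1 ^ 5) / √(m 2 - m 1 ^ 2) ^ 5 := by
  set μ := posteriorMeasure Θ f prior x n with hμ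
  have hθ : ∀ θ : ℝ, θ = t₀ + h * ((θ - t₀) / h) := fun θ => by field_simp; ring
  have hX1 : Integrable (fun θ : ℝ => (θ - t₀) / h) μ := by simpa using hX 1 (by norm_num)
  have hm1 : ∫ θ, (θ - t₀) / h ∂μ = m 1 := by simpa using hm 1 (by norm_num)
  have hmean : posteriorMean Θ f prior x n = t₀ + h * m 1 := by
    unfold posteriorMean
    rw [← hμ]
    calc ∫ θ, θ ∂μ = ∫ θ, (t₀ + h * ((θ - t₀) / h)) ∂μ := by
          congr 1; ext θ; exact hθ θ
      _ = _ := by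
          rw [integral_add (integrable_const _) (hX1.const_mul h), integral_const_mul, hm1]
          simp
  have hL5 : MemLp (fun θ : ℝ => (θ - t₀) / h) 5 μ := by
    have := (integrable_norm_rpow_iff (μ := μ) (p := 5) (f := fun θ : ℝ => (θ - t₀) / h)
      (by fun_prop) (by norm_num) (by norm_num)).1 (by
        refine (hX 5 le_rfl).norm.congr (ae_of_all _ fun θ => ?_)
        simp only [norm_pow, ENNReal.toReal_ofNat]
        exact_mod_cast (Real.rpow_natCast _ 5).symm)
    exact this
  have hmem : MemLp (fun θ : ℝ => θ) 5 μ := by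
    have h1 := (memLp_const t₀ (μ := μ) (p := 5)).add (hL5.const_mul h)
    convert! h1 using 1
    ext θ
    exact hθ θ
  have hvar : variance (fun θ : ℝ => θ) μ = h ^ 2 * (m 2 - m 1 ^ 2) := by
    have e : (fun θ : ℝ => θ) = fun θ => t₀ + h * ((θ - t₀) / h) := by ext θ; exact hθ θ
    rw [e, variance_const_add (by fun_prop), variance_const_mul,
      variance_eq_sub (hL5.mono_exponent (by norm_num)), hm1]
    congr 2
    exact hm 2 (by norm_num)
  have hSD : posteriorSD Θ f prior x n = h * √(m 2 - m 1 ^ 2) := by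
    unfold posteriorSD
    rw [← hμ, hvar, Real.sqrt_mul (by positivity), Real.sqrt_sq h0.le]
  have hs : 0 < √(m 2 - m 1 ^ 2) := Real.sqrt_pos.2 hV
  -- Standardizing `θ` and standardizing `(θ - t₀) / h` give the same variable.
  have hst : (fun θ : ℝ => (θ - posteriorMean Θ f prior x n) / posteriorSD Θ f prior x n) =
      fun θ => ((θ - t₀) / h - m 1) / √(m 2 - m 1 ^ 2) := by
    ext θ
    rw [hmean, hSD]
    field_simp
    ring
  refine ⟨hmem, by rw [hSD]; positivity, ?_⟩
  unfold invariantCumulant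
  rw [hst, ← hμ]
  exact cumulant_standardize hX hm hs.ne'

end Posterior

/-! ### Uniform bound on the invariant cumulants and the rate in `n` -/

/-- Laplace approximation of the posterior at a fixed large sample size. -/
lemma exists_posterior_bound {ε δ c : ℝ} (M m C : ℝ) (hε : 0 < ε) (hδ : 0 < δ) (hc : 0 < c) :
    ∃ B : ℝ, ∀ᶠ n : ℕ in atTop, ∀ {𝓧 : Type*} (Θ : Set ℝ) (f : 𝓧 → ℝ → ℝ) (prior : ℝ → ℝ)
      (x : ℕ → 𝓧) (t₀ : ℝ),
      LaplaceRegular Θ (likelihood f x n) prior t₀ n ε δ c M m C →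
      (IsProbabilityMeasure (posteriorMeasure Θ f prior x n) ∧
        MemLp (fun θ : ℝ => θ) 5 (posteriorMeasure Θ f prior x n) ∧
        0 < posteriorSD Θ f prior x n) ∧
      ∃ h : ℝ, 0 < h ∧ c * n * h ^ 2 ≤ 1 ∧
        ∀ j ∈ ({3, 4, 5} : Finset ℕ), |invariantCumulant Θ f prior x n j| ≤ B * h ^ (j - 2) := by
  obtain ⟨K, hK⟩ := exists_moment_expansion M m C hε hδ hc
  obtain ⟨B, hB0, hB⟩ := exists_cumulant_numerator_bound (K + (8 * K + 240 * K ^ 2))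
  -- The variance of the rescaled parameter is at least `1/4`, so dividing by at most five powers of
  -- its root costs at most `2⁵`.
  refine ⟨32 * B, ?_⟩
  filter_upwards [hK, tendsto_natCast_atTop_atTop.eventually
    (eventually_ge_atTop (2 * (|K| + B) / c))] with n hn hnc 𝓧 Θ f prior x t₀ H
  rw [div_le_iff₀ hc] at hnc
  obtain ⟨h, A, b, g, r, I, h0, h1, hch, hg, hA, hb, hr, hI, I0, I1, I2, I3, I4, I5⟩ :=
    hn Θ _ prior t₀ H
  have hK0 : 0 ≤ K := (abs_nonneg _).trans hA
  -- One threshold serves twice: `K * h² ≤ 1/2` keeps `I 0` away from zero and `B * h² ≤ 1/2` keeps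
  -- the variance away from zero.
  have hsmall : (K + B) * h ^ 2 ≤ 1 / 2 := by
    rw [abs_of_nonneg hK0] at hnc
    have : 2 * (K + B) * h ^ 2 ≤ n * c * h ^ 2 := by gcongr
    linarith
  have hKh : K * h ^ 2 ≤ 1 / 2 := by linarith [mul_nonneg hB0 (sq_nonneg h)]
  have hBh : B * h ^ 2 ≤ 1 / 2 := by linarith [mul_nonneg hK0 (sq_nonneg h)]
  obtain ⟨hI0, R, hR, N1, N2, N3, N4, N5⟩ :=
    exists_normalized_expansion hA hb hr hKh I0 I1 I2 I3 I4 I5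
  have hR' : 0 ≤ 8 * K + 240 * K ^ 2 := by positivity
  obtain ⟨B2, B3, B4, B5⟩ := hB h A b R (fun k => I k / I 0) h0 h1 (by linarith) (by linarith)
    (fun k hk => (hR k hk).trans (by linarith)) N1 N2 N3 N4 N5
  have ht₀ : t₀ ∈ Set.Ioo (t₀ - ε) (t₀ + ε) := ⟨by linarith, by linarith⟩
  obtain ⟨-, hL₀, hp₀⟩ := H.nhd t₀ ht₀
  have hd : 0 < prior t₀ * likelihood f x n t₀ := by positivity
  have hZ : ∫ θ in Θ, prior θ * likelihood f x n θ / (prior t₀ * likelihood f x n t₀) = g * I 0 := by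
    simpa using (hI 0 (by norm_num)).2
  have hZ0 : 0 < ∫ θ in Θ, prior θ * likelihood f x n θ / (prior t₀ * likelihood f x n t₀) := by
    rw [hZ]; positivity
  have hprob := posterior_isProbabilityMeasure H.measurableSet H.measurable_prior H.measurable_lik
    H.prior_nonneg H.lik_nonneg hd hZ0 (by simpa using (hI 0 (by norm_num)).1)
  have hpost := fun k hk => posterior_integral H.measurableSet H.measurable_prior H.measurable_lik
    H.prior_nonneg H.lik_nonneg hd hZ0 (fun θ => ((θ - t₀) / h) ^ k) (hI k hk).1
  set V := I 2 / I 0 - (I 1 / I 0) ^ 2 with hVdef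
  have hV : 1 / 4 ≤ V := by
    have := (abs_le.1 (B2.trans hBh)).1
    linarith
  obtain ⟨hmem, hSD, c3, c4, c5⟩ := posterior_cumulants (m := fun k => I k / I 0) h0
    (fun k hk => (hpost k hk).1) (fun k hk => by
      rw [(hpost k hk).2, (hI k hk).2, hZ, mul_div_mul_left _ _ hg.ne'])
    (by linarith : 0 < V)
  refine ⟨⟨hprob, hmem, hSD⟩, h, h0, hch, ?_⟩
  have hs : 1 / 2 ≤ √V := by
    apply Real.le_sqrt_of_sq_le
    linarith
  have hfin : ∀ (y : ℝ) (i j : ℕ), j ≤ 5 → |y| ≤ B * h ^ i → |y / √V ^ j| ≤ 32 * B * h ^ i := by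
    intro y i j hj hy
    have hpos : 0 < √V ^ j := by positivity
    have h32 : 1 / 32 ≤ √V ^ j := by
      calc (1 / 32 : ℝ) = (1 / 2) ^ 5 := by norm_num
        _ ≤ (1 / 2) ^ j := pow_le_pow_of_le_one (by norm_num) (by norm_num) hj
        _ ≤ _ := by gcongr
    rw [abs_div, abs_of_pos hpos, div_le_iff₀ hpos]
    calc |y| ≤ B * h ^ i := hy
      _ = 32 * B * h ^ i * (1 / 32) := by ring
      _ ≤ _ := by gcongr
  intro j hj
  simp only [Finset.mem_insert, Finset.mem_singleton] at hj
  rcases hj with rfl | rfl | rfl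
  · rw [c3]
    exact hfin _ 1 3 (by norm_num) (by rw [pow_one]; exact B3)
  · rw [c4]
    exact hfin _ 2 4 (by norm_num) B4
  · rw [c5]
    exact hfin _ 3 5 le_rfl B5

lemma pow_le_rpow_of_mul_sq_le {c n h : ℝ} (hc : 0 < c) (hn : 0 < n) (h0 : 0 < h)
    (hch : c * n * h ^ 2 ≤ 1) {j : ℕ} (hj : 2 ≤ j) :
    h ^ (j - 2) ≤ c ^ ((2 - (j : ℝ)) / 2) * n ^ ((2 - (j : ℝ)) / 2) := by
  have hcast : ((j - 2 : ℕ) : ℝ) = (j : ℝ) - 2 := by push_cast [Nat.cast_sub hj]; ring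
  have hle : h ≤ (c * n) ^ (-(1 / 2) : ℝ) := by
    rw [Real.rpow_neg (by positivity), ← Real.sqrt_eq_rpow, ← Real.sqrt_inv]
    apply Real.le_sqrt_of_sq_le
    rw [← one_div, le_div_iff₀ (by positivity)]
    linarith
  calc h ^ (j - 2) ≤ ((c * n) ^ (-(1 / 2) : ℝ)) ^ (j - 2) := by gcongr
    _ = (c * n) ^ ((2 - (j : ℝ)) / 2) := by
      rw [← Real.rpow_mul_natCast (by positivity), hcast]
      congr 1
      ring
    _ = _ := Real.mul_rpow hc.le hn.le

theorem lemma1 {𝓧 : Type*} (Θ : Set ℝ) (f : 𝓧 → ℝ → ℝ) (prior : ℝ → ℝ) (x : ℕ → 𝓧)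
    (θhat : ℕ → ℝ) (n₀ : ℕ) (ε δ c M m C : ℝ)
    (hΘ : MeasurableSet Θ)
    (hf : ∀ y, Measurable (f y)) (hf_nonneg : ∀ y, ∀ θ ∈ Θ, 0 ≤ f y θ)
    (hprior : Measurable prior) (hprior_nonneg : ∀ θ ∈ Θ, 0 ≤ prior θ)
    (hε : 0 < ε) (hδ : 0 < δ) (hc : 0 < c) (hm : 0 ≤ m)
    -- a neighborhood of fixed radius of the maximizer, where both logarithms make sense
    (hnhd : ∀ n ≥ n₀, ∀ θ ∈ Set.Ioo (θhat n - ε) (θhat n + ε),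
      θ ∈ Θ ∧ 0 < likelihood f x n θ ∧ 0 < prior θ)
    -- the single global maximizer of the likelihood
    (hmax : ∀ n ≥ n₀, ∀ θ ∈ Θ, θ ≠ θhat n → likelihood f x n θ < likelihood f x n (θhat n))
    -- six continuous derivatives, bounded uniformly in `n`
    (hsmooth : ∀ n ≥ n₀, ContDiffOn ℝ 6 (avgLogLik f x n)
      (Set.Ioo (θhat n - ε) (θhat n + ε)))
    (hbound : ∀ n ≥ n₀, ∀ j ∈ Finset.Icc 2 6, ∀ θ ∈ Set.Ioo (θhat n - ε) (θhat n + ε),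
      |iteratedDeriv j (avgLogLik f x n) θ| ≤ M)
    (hprior_smooth : ∀ n ≥ n₀, ContDiffOn ℝ 6 (fun θ => Real.log (prior θ))
      (Set.Ioo (θhat n - ε) (θhat n + ε)))
    (hprior_bound : ∀ n ≥ n₀, ∀ j ∈ Finset.Icc 0 6,
      ∀ θ ∈ Set.Ioo (θhat n - ε) (θhat n + ε),
      |iteratedDeriv j (fun t => Real.log (prior t)) θ| ≤ M)
    -- separation outside the neighborhood (trivial where the loglikelihood is `-∞`)
    (hsep : ∀ n ≥ n₀, ∀ θ ∈ Θ, θ ∉ Set.Ioo (θhat n - ε) (θhat n + ε) →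
      0 < likelihood f x n θ → avgLogLik f x n θ < avgLogLik f x n (θhat n) - δ)
    -- the second derivative is bounded away from zero
    (hcurv : ∀ n ≥ n₀, ∀ θ ∈ Set.Ioo (θhat n - ε) (θhat n + ε),
      c ≤ |iteratedDeriv 2 (avgLogLik f x n) θ|)
    -- moments of order five, against the prior weighted by `exp (m * (average loglikelihood))`
    -- (normalized at the maximizer); for `m = 0` these are moments of the prior
    (hmoment : ∀ n ≥ n₀,
      IntegrableOn (fun θ => |θ - θhat n| ^ 5 * prior θ *
        (likelihood f x n θ / likelihood f x n (θhat n)) ^ (m / (n : ℝ))) Θ volume ∧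
      ∫ θ in Θ, |θ - θhat n| ^ 5 * prior θ *
        (likelihood f x n θ / likelihood f x n (θhat n)) ^ (m / (n : ℝ)) ≤ C) :
    (∀ᶠ n in atTop, IsProbabilityMeasure (posteriorMeasure Θ f prior x n) ∧
      MemLp (fun θ : ℝ => θ) 5 (posteriorMeasure Θ f prior x n) ∧
      0 < posteriorSD Θ f prior x n) ∧
    ∀ j ∈ ({3, 4, 5} : Finset ℕ),
      (fun n : ℕ => invariantCumulant Θ f prior x n j) =O[atTop]
        (fun n : ℕ => (n : ℝ) ^ ((2 - (j : ℝ)) / 2)) := by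

  have hreg : ∀ n ≥ n₀, LaplaceRegular Θ (likelihood f x n) prior (θhat n) n ε δ c M m C := by
    intro n hn
    refine ⟨hΘ, ?_, fun θ hθ => Finset.prod_nonneg fun i _ => hf_nonneg _ θ hθ, hprior,
      hprior_nonneg, hnhd n hn, hmax n hn, hsmooth n hn, hbound n hn, hprior_smooth n hn,
      hprior_bound n hn, hsep n hn, hcurv n hn, (hmoment n hn).1, (hmoment n hn).2⟩
    unfold likelihood
    exact Finset.measurable_prod _ fun i _ => hf (x i)
  obtain ⟨B, hB⟩ := exists_posterior_bound M m C hε hδ hc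
  have hall := hB.and (eventually_ge_atTop n₀)
  constructor
  · filter_upwards [hall] with n hn
    exact (hn.1 Θ f prior x (θhat n) (hreg n hn.2)).1
  · intro j hj
    have hj2 : 2 ≤ j := by
      simp only [Finset.mem_insert, Finset.mem_singleton] at hj
      omega
    refine IsBigO.of_bound (|B| * c ^ ((2 - (j : ℝ)) / 2)) ?_
    filter_upwards [hall, eventually_gt_atTop 0] with n hn hpos
    obtain ⟨-, h, h0, hch, hκ⟩ := hn.1 Θ f prior x (θhat n) (hreg n hn.2)
    have hn0 : (0 : ℝ) < n := by exact_mod_cast hpos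
    rw [Real.norm_eq_abs, Real.norm_eq_abs, abs_of_pos (Real.rpow_pos_of_pos hn0 _), mul_assoc]
    calc _ ≤ B * h ^ (j - 2) := hκ j hj
      _ ≤ |B| * h ^ (j - 2) := by gcongr; exact le_abs_self B
      _ ≤ _ := by gcongr; exact pow_le_rpow_of_mul_sq_le hc hn0 h0 hch hj2
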